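/- **Definitions.** A *Boolean algebra* is an associative commutative algebra over $\mathbf F_2$, not necessarily with $1$, satisfying $x^2=x$. A *measure algebra* $(H,\mu)$ is a Boolean algebra $H$ with a function $\mu:H\to[0,\infty)$ such that $\mu(a)=0$ if and only if $a=0$, and $\mu(a+b)=\mu(a)+\mu(b)$ whenever $ab=0$. Two measure algebras $(H_1,\mu_1)$, $(H_2,\mu_2)$ are *scalar equivalent* if there are $\alpha>0$ and an isomorphism $\varphi:H_1\to H_2$ of Boolean algebras with $\mu_2(\varphi(a))=\alpha\mu_1(a)$ for all $a$. The *standard* measure algebra $\mathbf{St}_n$ is $\mathbf F_2^n$ with $\mu_n(x_1,\dots,x_n)=\frac1n(x_1+\cdots+x_n)$. A measure algebra is *locally standard* if every finite subset is contained in a subalgebra that, with the restricted measure, is scalar equivalent to $\mathbf{St}_n$ for some $n\ge1$. The tensor product $H_1\otimes_{\mathbf F_2}H_2$ carries the unique measure with $\mu(a\otimes b)=\mu_1(a)\mu_2(b)$. A *Steinitz number* is a formal product $s=\prod_p p^{s_p}$ over all primes, $s_p\in\{0,1,2,\dots,\infty\}$; it is *infinite* if it is not a positive integer; $\Omega(s)$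 is the set of positive integers dividing $s$. $H(s)$ is the algebra of periodic $0$–$1$ sequences whose minimal period divides $s$, the measure of a sequence of period $k$ being the average of its first $k$ terms. $H(\infty)$ is the algebra of finite subsets of a countably infinite set with the counting measure. Let $r\ge1$ be real, let $s$ be an infinite Steinitz number, and choose $b_i\in\Omega(s)$ with $b_i\mid b_{i+1}$ and least common multiple $s$. Put $m_i=[rb_i]$ to define $H(r,s)$; to define $H^+(r,s)$, put $m_i=[rb_i]$ if $rb_i\notin\mathbb N$ and $m_i=rb_i-1$ if $rb_i\in\mathbb N$. Then $H(r,s)$, respectively $H^+(r,s)$, is the union of the chain of $M_i=\mathbf{St}_{m_i}\otimes H(s/b_i)$, where $M_i\cong\mathbf{St}_{m_ib_{i+1}/b_i}\otimes H(s/b_{i+1})$ is embedded into $M_{i+1}$ as the corner given by the first $m_ib_{i+1}/b_i$ coordinates of $\mathbf{St}_{m_{i+1}}$, with the measure that is $\frac{m_i}{b_i}$ times the measure of $M_i$ on $M_i$. **Theorem.** (1) Every countable locally standard measure algebra is scalar equivalent to one of the following: $$\mathbf{St}_n\ (n\ge1);\qquad H(\infty)\otimes H(s)\ (s \text{ a Steinitz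 number});\qquad H(r,s),\ H^+(r,s)\ (r\in[1,\infty),\ s\text{ an infinite Steinitz number}).$$ (2) All the measure algebras in this list are countable and locally standard. (3) The only scalar equivalences between members of the list are the following, where the choice of the sequences $(b_i)$ does not matter. $\mathbf{St}_n$ and $\mathbf{St}_{n'}$ are scalar equivalent iff $n=n'$. $H(\infty)\otimes H(s)$ and $H(\infty)\otimes H(s')$ are scalar equivalent iff $vs=us'$ for some positive integers $u,v$. $H(r,s)$ and $H(r',s')$ are scalar equivalent iff $vs=us'$ and $vr'=ur$ for some positive integers $u,v$; the same condition describes when $H^+(r,s)$ and $H^+(r',s')$ are scalar equivalent. $H(r,s)$ and $H^+(r',s')$ are scalar equivalent iff this condition holds and $r$ is not of the form $a/b$ with $a\in\mathbb N$, $b\in\Omega(s)$. -/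

import Mathlib

open scoped TensorProduct
universe u v

noncomputable section

/-- A Boolean algebra, in the sense of an associative commutative algebra over `𝔽₂`, not necessarily
with `1`, satisfying `x * x = x`, together with a measure `μ`. -/
structure MeasureAlgebra : Type (u + 1) where
  carrier : Type u
  [ring : NonUnitalCommRing carrier]
  [module : Module (ZMod 2) carrier]
  [tower : IsScalarTower (ZMod 2) carrier carrier]
  [smulComm : SMulCommClass (ZMod 2) carrier carrier]
  mul_self' : ∀ x : carrier, x * x = x
  μ : carrier → ℝ
  nonneg' : ∀ x, 0 ≤ μ x
  eq_zero_iff' : ∀ x, μ x = 0 ↔ x = 0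
  add' : ∀ x y, x * y = 0 → μ (x + y) = μ x + μ y

namespace MeasureAlgebra

instance : CoeSort MeasureAlgebra.{u} (Type u) := ⟨carrier⟩

instance (H : MeasureAlgebra.{u}) : NonUnitalCommRing H := H.ring
instance (H : MeasureAlgebra.{u}) : Module (ZMod 2) H := H.module
instance (H : MeasureAlgebra.{u}) : IsScalarTower (ZMod 2) H H := H.tower
instance (H : MeasureAlgebra.{u}) : SMulCommClass (ZMod 2) H H := H.smulComm

/-- Scalar equivalence of measure algebras. (Additive maps are automatically `𝔽₂`-linear.) -/
def ScalarEquiv (H₁ : MeasureAlgebra.{u}) (H₂ : MeasureAlgebra.{v}) : Prop :=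
  ∃ α : ℝ, 0 < α ∧ ∃ φ : H₁ ≃+* H₂, ∀ a : H₁, H₂.μ (φ a) = α * H₁.μ a

/-- A subalgebra (its unit, if any, need not be a unit of `H`) with the restricted measure. -/
def restrict (H : MeasureAlgebra.{u}) (K : NonUnitalSubalgebra (ZMod 2) H) :
    MeasureAlgebra.{u} where
  carrier := K
  mul_self' x := Subtype.ext (H.mul_self' x)
  μ x := H.μ x
  nonneg' x := H.nonneg' x
  eq_zero_iff' x := by rw [H.eq_zero_iff']; exact ZeroMemClass.coe_eq_zero
  add' x y h := H.add' x y (congrArg Subtype.val h)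

/-- The standard measure algebra `𝔽₂ⁿ` with `μ (x₁, …, xₙ) = (x₁ + ⋯ + xₙ) / n`. -/
def St (n : ℕ) : MeasureAlgebra.{0} where
  carrier := Fin n → ZMod 2
  mul_self' x := funext fun i => by
    have : ∀ z : ZMod 2, z * z = z := by decide
    exact this (x i)
  μ x := (∑ i, ((x i).val : ℝ)) / n
  nonneg' x := by positivity
  eq_zero_iff' x := by
    rcases Nat.eq_zero_or_pos n with rfl | hn
    · simp [Subsingleton.elim x 0]
    · have hn' : (n : ℝ) ≠ 0 := by positivity
      rw [div_eq_zero_iff, or_iff_left hn', Finset.sum_eq_zero_iff_of_nonneg (by intros; positivity)]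
      simp only [Finset.mem_univ, true_imp_iff, Nat.cast_eq_zero, ZMod.val_eq_zero]
      exact funext_iff.symm
  add' x y h := by
    rw [← add_div, ← Finset.sum_add_distrib]
    congr 1
    refine Finset.sum_congr rfl fun i _ => ?_
    have key : ∀ a b : ZMod 2, a * b = 0 → (a + b).val = a.val + b.val := by decide
    exact_mod_cast key (x i) (y i) (congrFun h i)

/-- Every finite subset lies in a measure subalgebra that is scalar equivalent to some `St n`. -/
def LocallyStandard (H : MeasureAlgebra.{u}) : Prop :=
  ∀ F : Set H, F.Finite → ∃ K : NonUnitalSubalgebra (ZMod 2) H, F ⊆ K ∧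
    ∃ n : ℕ, 1 ≤ n ∧ ScalarEquiv (H.restrict K) (St n)

/-- The finite subsets of a countable infinite set, written as their indicator functions, with
the counting measure. -/
def Hinf : MeasureAlgebra.{0} where
  carrier := ({ carrier := {a | (Function.support a).Finite}
                add_mem' := fun {a b} ha hb =>
                  (ha.union hb).subset (Function.support_add a b)
                zero_mem' := by simp
                mul_mem' := fun {a b} ha _ => ha.subset (Function.support_mul_subset_left a b)
                smul_mem' := fun c {a} ha => ha.subset (Function.support_const_smul_subset c a) } :
    NonUnitalSubalgebra (ZMod 2) (ℕ → ZMod 2))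
  mul_self' x := Subtype.ext <| funext fun i => by
    have : ∀ z : ZMod 2, z * z = z := by decide
    exact this (x.1 i)
  μ x := ((Function.support x.1).ncard : ℝ)
  nonneg' x := by positivity
  eq_zero_iff' x := by
    rw [Nat.cast_eq_zero, Set.ncard_eq_zero x.2, Function.support_eq_empty_iff]
    exact ZeroMemClass.coe_eq_zero
  add' x y h := by
    have h' : ∀ i, x.1 i * y.1 i = 0 := fun i => congrFun (congrArg Subtype.val h) i
    have key : ∀ a b : ZMod 2, a * b = 0 → (a + b ≠ 0 ↔ a ≠ 0 ∨ b ≠ 0) := by decide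
    have key2 : ∀ a b : ZMod 2, a * b = 0 → a ≠ 0 → ¬ b ≠ 0 := by decide
    have hs : Function.support (x + y).1 = Function.support x.1 ∪ Function.support y.1 := by
      ext i
      exact key _ _ (h' i)
    have hd : Disjoint (Function.support x.1) (Function.support y.1) :=
      Set.disjoint_left.2 fun i => key2 _ _ (h' i)
    rw [hs, Set.ncard_union_eq hd x.2 y.2]
    push_cast
    rfl

end MeasureAlgebra

namespace MeasureAlgebra

variable {A : MeasureAlgebra.{u}} {B : MeasureAlgebra.{v}}

lemma μ_zero (A : MeasureAlgebra.{u}) : A.μ 0 = 0 := (A.eq_zero_iff' 0).2 rfl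

lemma μ_sum {ι : Type*} (s : Finset ι) (a : ι → A)
    (h : ∀ i ∈ s, ∀ j ∈ s, i ≠ j → a i * a j = 0) :
    A.μ (∑ i ∈ s, a i) = ∑ i ∈ s, A.μ (a i) := by
  classical
  induction s using Finset.induction_on with
  | empty => simp [μ_zero]
  | insert i s hi ih =>
    rw [Finset.sum_insert hi, Finset.sum_insert hi, A.add', ih]
    · exact fun j hj k hk => h j (Finset.mem_insert_of_mem hj) k (Finset.mem_insert_of_mem hk)
    · rw [Finset.mul_sum]
      refine Finset.sum_eq_zero fun j hj => h i (Finset.mem_insert_self _ _) j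
        (Finset.mem_insert_of_mem hj) ?_
      rintro rfl
      exact hi hj

lemma μ_split (x c : A) : A.μ x = A.μ (x * c) + A.μ (x - x * c) := by
  rw [← A.add']
  · congr 1; abel
  · rw [mul_sub, A.mul_self', mul_right_comm, A.mul_self', sub_self]

/-- The element `t` of the tensor product is `∑ aᵢ ⊗ bᵢ` with pairwise orthogonal `aᵢ`. -/
def IsRep {ι : Type} [Fintype ι] (a : ι → A) (b : ι → B) (t : A ⊗[ZMod 2] B) : Prop :=
  (∀ i j, i ≠ j → a i * a j = 0) ∧ t = ∑ i, a i ⊗ₜ[ZMod 2] b i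

lemma orth_mul_sum {ι : Type*} [Fintype ι] (a : ι → A) (h : ∀ i j, i ≠ j → a i * a j = 0)
    (i : ι) : a i * ∑ j, a j = a i := by
  classical
  rw [Finset.mul_sum, Finset.sum_eq_single i, A.mul_self']
  · exact fun j _ hj => h i j hj.symm
  · simp

lemma exists_common {ι κ : Type} [Fintype ι] [Fintype κ] {a : ι → A} {b : ι → B}
    {c : κ → A} {d : κ → B} {t t' : A ⊗[ZMod 2] B} (h : IsRep a b t) (h' : IsRep c d t') :
    ∃ (l : Type) (_ : Fintype l) (e : l → A) (f g : l → B), IsRep e f t ∧ IsRep e g t' ∧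
      ∑ k, A.μ (e k) * B.μ (f k) = ∑ i, A.μ (a i) * B.μ (b i) ∧
      ∑ k, A.μ (e k) * B.μ (g k) = ∑ j, A.μ (c j) * B.μ (d j) := by
  classical
  obtain ⟨ha, rfl⟩ := h
  obtain ⟨hc, rfl⟩ := h'
  set S := ∑ i, a i with hS
  set C := ∑ j, c j with hC
  have haS : ∀ i, a i * S = a i := orth_mul_sum a ha
  have hcC : ∀ j, c j * C = c j := orth_mul_sum c hc
  have oac : ∀ i j k, a i * c j * (a k - a k * C) = 0 := fun i j k => by
    rw [mul_sub, ← mul_assoc, mul_right_comm (a i), mul_assoc (a i * a k), hcC, sub_self]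
  have oca : ∀ i j k, a i * c j * (c k - c k * S) = 0 := fun i j k => by
    rw [mul_comm (a i), mul_sub, ← mul_assoc, mul_right_comm (c j), mul_assoc (c j * c k), haS,
      sub_self]
  have orr : ∀ i j, (a i - a i * C) * (c j - c j * S) = 0 := fun i j => by
    have e1 : a i * (c j * S) = a i * c j := by rw [mul_left_comm, haS, mul_comm]
    have e2 : a i * C * c j = a i * c j := by rw [mul_assoc, mul_comm C, hcC]
    have e3 : a i * C * (c j * S) = a i * c j := by
      rw [mul_comm (c j), mul_mul_mul_comm, haS, mul_comm C, hcC]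
    rw [sub_mul, mul_sub, mul_sub, e1, e2, e3]; simp
  have ora : ∀ i k, i ≠ k → (a i - a i * C) * (a k - a k * C) = 0 := fun i k hik => by
    simp [sub_mul, mul_sub, ← mul_assoc, ha i k hik, mul_right_comm _ C]
  have orc : ∀ i k, i ≠ k → (c i - c i * S) * (c k - c k * S) = 0 := fun i k hik => by
    simp [sub_mul, mul_sub, ← mul_assoc, hc i k hik, mul_right_comm _ S]
  have horth : ∀ i j : (ι × κ) ⊕ ι ⊕ κ, i ≠ j →
      Sum.elim (fun p : ι × κ => a p.1 * c p.2)
        (Sum.elim (fun i => a i - a i * C) (fun j => c j - c j * S)) i *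
      Sum.elim (fun p : ι × κ => a p.1 * c p.2)
        (Sum.elim (fun i => a i - a i * C) (fun j => c j - c j * S)) j = 0 := by
    rintro (⟨i, j⟩ | i | j) (⟨k, l⟩ | k | l) hne
    · simp only [Sum.elim_inl]
      rw [mul_mul_mul_comm]
      by_cases hik : i = k
      · have : j ≠ l := by rintro rfl; exact hne (by rw [hik])
        rw [hc j l this, mul_zero]
      · rw [ha i k hik, zero_mul]
    · exact oac i j k
    · exact oca i j l
    · exact (mul_comm _ _).trans (oac k l i)
    · exact ora i k (fun h => hne (by rw [h]))
    · exact orr i l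
    · exact (mul_comm _ _).trans (oca k l j)
    · exact (mul_comm _ _).trans (orr k j)
    · exact orc j l (fun h => hne (by rw [h]))
  refine ⟨(ι × κ) ⊕ ι ⊕ κ, inferInstance, Sum.elim (fun p => a p.1 * c p.2)
    (Sum.elim (fun i => a i - a i * C) (fun j => c j - c j * S)),
    Sum.elim (fun p => b p.1) (Sum.elim b 0), Sum.elim (fun p => d p.2) (Sum.elim 0 d),
    ⟨horth, ?_⟩, ⟨horth, ?_⟩, ?_, ?_⟩
  · simp only [Fintype.sum_sum_type, Sum.elim_inl, Sum.elim_inr, Pi.zero_apply,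
      TensorProduct.tmul_zero, Finset.sum_const_zero, add_zero, Fintype.sum_prod_type]
    rw [← Finset.sum_add_distrib]
    refine Finset.sum_congr rfl fun i _ => ?_
    rw [← TensorProduct.sum_tmul, ← Finset.mul_sum, ← TensorProduct.add_tmul]
    congr 1; abel
  · simp only [Fintype.sum_sum_type, Sum.elim_inl, Sum.elim_inr, Pi.zero_apply,
      TensorProduct.tmul_zero, Finset.sum_const_zero, zero_add, Fintype.sum_prod_type_right]
    rw [← Finset.sum_add_distrib]
    refine Finset.sum_congr rfl fun j _ => ?_
    rw [← TensorProduct.sum_tmul, ← Finset.sum_mul, ← TensorProduct.add_tmul, mul_comm _ (c j)]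
    congr 1; abel
  · simp only [Fintype.sum_sum_type, Sum.elim_inl, Sum.elim_inr, Pi.zero_apply,
      μ_zero, mul_zero, Finset.sum_const_zero, add_zero, Fintype.sum_prod_type]
    rw [← Finset.sum_add_distrib]
    refine Finset.sum_congr rfl fun i _ => ?_
    rw [← Finset.sum_mul, ← add_mul, μ_split (a i) C, hC, Finset.mul_sum, μ_sum]
    intro j _ k _ hjk
    rw [mul_mul_mul_comm, hc j k hjk, mul_zero]
  · simp only [Fintype.sum_sum_type, Sum.elim_inl, Sum.elim_inr, Pi.zero_apply,
      μ_zero, mul_zero, Finset.sum_const_zero, zero_add, Fintype.sum_prod_type_right]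
    rw [← Finset.sum_add_distrib]
    refine Finset.sum_congr rfl fun j _ => ?_
    rw [← Finset.sum_mul, ← add_mul, μ_split (c j) S, hS, Finset.mul_sum, μ_sum]
    · simp only [mul_comm]
    intro i _ k _ hik
    rw [mul_mul_mul_comm, ha i k hik, mul_zero]

lemma exists_rep (t : A ⊗[ZMod 2] B) :
    ∃ (ι : Type) (_ : Fintype ι) (a : ι → A) (b : ι → B), IsRep a b t := by
  induction t using TensorProduct.induction_on with
  | zero => exact ⟨Empty, inferInstance, fun _ => 0, fun _ => 0, by simp [IsRep]⟩
  | tmul x y => exact ⟨Unit, inferInstance, fun _ => x, fun _ => y, by simp [IsRep]⟩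
  | add t t' h h' =>
    obtain ⟨ι, _, a, b, h⟩ := h
    obtain ⟨κ, _, c, d, h'⟩ := h'
    obtain ⟨l, i, e, f, g, h1, h2, -⟩ := exists_common h h'
    refine ⟨l, i, e, f + g, h1.1, ?_⟩
    rw [h1.2, h2.2, ← Finset.sum_add_distrib]
    simp [TensorProduct.tmul_add]

lemma IsRep.coeff {ι : Type} [Fintype ι] {a : ι → A} {b : ι → B} (h : IsRep a b 0) (i : ι) :
    a i = 0 ∨ b i = 0 := by
  classical
  by_contra! hne
  obtain ⟨ψ, hψ⟩ := Module.Projective.exists_dual_eq_one (ZMod 2) hne.1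
  let F : A ⊗[ZMod 2] B →ₗ[ZMod 2] B :=
    TensorProduct.lid (ZMod 2) B ∘ₗ
      LinearMap.rTensor B (ψ ∘ₗ LinearMap.mulLeft (ZMod 2) (a i))
  have hF := congrArg F h.2
  rw [map_zero, map_sum, Finset.sum_eq_single i] at hF
  · simp [F, A.mul_self', hψ] at hF
    exact hne.2 hF.symm
  · intro j _ hj
    simp [F, h.1 i j hj.symm]
  · simp

lemma IsRep.sum_eq {ι κ : Type} [Fintype ι] [Fintype κ] {a : ι → A} {b : ι → B}
    {c : κ → A} {d : κ → B} {t : A ⊗[ZMod 2] B} (h : IsRep a b t) (h' : IsRep c d t) :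
    ∑ i, A.μ (a i) * B.μ (b i) = ∑ j, A.μ (c j) * B.μ (d j) := by
  obtain ⟨l, _, e, f, g, h1, h2, h3, h4⟩ := exists_common h h'
  rw [← h3, ← h4]
  have h0 : IsRep e (f - g) 0 := by
    refine ⟨h1.1, ?_⟩
    simp only [Pi.sub_apply, TensorProduct.tmul_sub, Finset.sum_sub_distrib]
    rw [← h1.2, ← h2.2, sub_self]
  refine Finset.sum_congr rfl fun k _ => ?_
  rcases h0.coeff k with hk | hk
  · rw [hk, μ_zero, zero_mul, zero_mul]
  · rw [sub_eq_zero.1 hk]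

/-- The measure on the tensor product: `∑ aᵢ ⊗ bᵢ` with pairwise orthogonal `aᵢ` has measure
`∑ μ(aᵢ) μ(bᵢ)`. It is the unique measure with `μ(a ⊗ b) = μ(a) μ(b)`, see `tensorμ_tmul` and
`tensor_ext`. -/
def tensorμ (t : A ⊗[ZMod 2] B) : ℝ :=
  let _ : Fintype (exists_rep t).choose := (exists_rep t).choose_spec.choose
  ∑ i, A.μ ((exists_rep t).choose_spec.choose_spec.choose i) *
    B.μ ((exists_rep t).choose_spec.choose_spec.choose_spec.choose i)

lemma IsRep.tensorμ_eq {ι : Type} [Fintype ι] {a : ι → A} {b : ι → B} {t : A ⊗[ZMod 2] B}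
    (h : IsRep a b t) : tensorμ t = ∑ i, A.μ (a i) * B.μ (b i) := by
  let _ : Fintype (exists_rep t).choose := (exists_rep t).choose_spec.choose
  exact IsRep.sum_eq (exists_rep t).choose_spec.choose_spec.choose_spec.choose_spec h

lemma tensorμ_tmul (x : A) (y : B) : tensorμ (x ⊗ₜ[ZMod 2] y) = A.μ x * B.μ y := by
  have h : IsRep (fun _ : Unit => x) (fun _ => y) (x ⊗ₜ[ZMod 2] y) := by simp [IsRep]
  simpa using h.tensorμ_eq

variable (A B) in
/-- The tensor product over `𝔽₂` of two measure algebras. -/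
def tensor : MeasureAlgebra.{max u v} where
  carrier := A ⊗[ZMod 2] B
  ring :=
    { (inferInstance : NonUnitalRing (A ⊗[ZMod 2] B)) with
      mul_comm := fun x y => by
        induction x using TensorProduct.induction_on with
        | zero => simp
        | add a b ha hb => rw [add_mul, mul_add, ha, hb]
        | tmul a b =>
          induction y using TensorProduct.induction_on with
          | zero => simp
          | add a b ha hb => rw [add_mul, mul_add, ha, hb]
          | tmul c d => simp [mul_comm] }
  mul_self' t := by
    obtain ⟨ι, _, a, b, h, rfl⟩ := exists_rep t
    classical
    rw [Finset.sum_mul]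
    refine Finset.sum_congr rfl fun i _ => ?_
    rw [Finset.mul_sum, Finset.sum_eq_single i]
    · simp [A.mul_self', B.mul_self']
    · intro j _ hj
      simp [h i j hj.symm]
    · simp
  μ := tensorμ
  nonneg' t := by
    obtain ⟨ι, _, a, b, h⟩ := exists_rep t
    rw [h.tensorμ_eq]
    exact Finset.sum_nonneg fun i _ => mul_nonneg (A.nonneg' _) (B.nonneg' _)
  eq_zero_iff' t := by
    obtain ⟨ι, _, a, b, h⟩ := exists_rep t
    rw [h.tensorμ_eq, Finset.sum_eq_zero_iff_of_nonneg
      fun i _ => mul_nonneg (A.nonneg' _) (B.nonneg' _)]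
    simp only [Finset.mem_univ, true_imp_iff, mul_eq_zero, A.eq_zero_iff', B.eq_zero_iff']
    constructor
    · intro h0
      rw [h.2]
      refine Finset.sum_eq_zero fun i _ => ?_
      rcases h0 i with hi | hi <;> simp [hi]
    · rintro rfl i
      exact h.coeff i
  add' t t' h := by
    classical
    obtain ⟨ι, _, a, b, h1⟩ := exists_rep t
    obtain ⟨κ, _, c, d, h2⟩ := exists_rep t'
    obtain ⟨l, _, e, f, g, h1, h2, -⟩ := exists_common h1 h2
    have h12 : IsRep e (f + g) (t + t') :=
      ⟨h1.1, by
        simp only [Pi.add_apply, TensorProduct.tmul_add, Finset.sum_add_distrib]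
        rw [← h1.2, ← h2.2]⟩
    have h0 : IsRep e (f * g) 0 := by
      refine ⟨h1.1, ?_⟩
      refine h.symm.trans ?_
      rw [h1.2, h2.2, Finset.sum_mul]
      refine Finset.sum_congr rfl fun i _ => ?_
      rw [Finset.mul_sum, Finset.sum_eq_single i]
      · simp [A.mul_self']
      · intro j _ hj
        simp [h1.1 i j hj.symm]
      · simp
    rw [h12.tensorμ_eq, h1.tensorμ_eq, h2.tensorμ_eq, ← Finset.sum_add_distrib]
    refine Finset.sum_congr rfl fun k _ => ?_
    rcases h0.coeff k with hk | hk
    · rw [hk, μ_zero]; ring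
    · rw [← mul_add, Pi.add_apply, B.add' _ _ hk]

/-- A finitely additive function on a tensor product is determined by its values on `a ⊗ b`. -/
lemma tensor_ext {m m' : tensor A B → ℝ}
    (hm : ∀ x y, x * y = 0 → m (x + y) = m x + m y)
    (hm' : ∀ x y, x * y = 0 → m' (x + y) = m' x + m' y)
    (h : ∀ (x : A) (y : B), m (x ⊗ₜ[ZMod 2] y) = m' (x ⊗ₜ[ZMod 2] y)) : m = m' := by
  classical
  have h0 : ∀ n : tensor A B → ℝ, (∀ x y, x * y = 0 → n (x + y) = n x + n y) → n 0 = 0 :=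
    fun n hn => by simpa using hn 0 0 (mul_zero _)
  have key : ∀ n : tensor A B → ℝ, (∀ x y, x * y = 0 → n (x + y) = n x + n y) →
      ∀ (ι : Type) (s : Finset ι) (a : ι → A) (b : ι → B), (∀ i j, i ≠ j → a i * a j = 0) →
      n (∑ i ∈ s, a i ⊗ₜ[ZMod 2] b i : A ⊗[ZMod 2] B) =
        ∑ i ∈ s, n (a i ⊗ₜ[ZMod 2] b i : A ⊗[ZMod 2] B) := by
    intro n hn ι s a b hab
    induction s using Finset.induction_on with
    | empty => exact h0 n hn
    | insert i s hi ih =>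
      rw [Finset.sum_insert hi, Finset.sum_insert hi, ← ih]
      refine hn _ _ ?_
      refine (Finset.mul_sum s (fun j => (a j ⊗ₜ[ZMod 2] b j : A ⊗[ZMod 2] B))
        (a i ⊗ₜ[ZMod 2] b i)).trans ?_
      refine Finset.sum_eq_zero fun j hj => ?_
      rw [Algebra.TensorProduct.tmul_mul_tmul, hab i j (by rintro rfl; exact hi hj),
        TensorProduct.zero_tmul]
  funext t
  obtain ⟨ι, _, a, b, hab, rfl⟩ := exists_rep t
  rw [key m hm ι _ a b hab, key m' hm' ι _ a b hab]
  exact Finset.sum_congr rfl fun i _ => h _ _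

end MeasureAlgebra

/-- A Steinitz number `∏ p ^ (s p)` is given by its exponents. -/
def SteinitzNumber : Type := Nat.Primes → ℕ∞

namespace SteinitzNumber

/-- The positive integer `n` as a Steinitz number. -/
def ofNat (n : ℕ) : SteinitzNumber := fun p => (n.factorization p : ℕ∞)

/-- The product of Steinitz numbers. -/
instance : Mul SteinitzNumber := ⟨fun s t p => s p + t p⟩

/-- The set of the positive integers that divide `s`. -/
def Ω (s : SteinitzNumber) : Set ℕ := {n | 0 < n ∧ ∀ p : Nat.Primes, (n.factorization p : ℕ∞) ≤ s p}

/-- The quotient `s / b`, for `b ∈ Ω s`. -/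
def quot (s : SteinitzNumber) (b : ℕ) : SteinitzNumber := fun p => s p - (b.factorization p : ℕ∞)

/-- A Steinitz number is infinite if it is not a positive integer. -/
def IsInfinite (s : SteinitzNumber) : Prop := ∀ n : ℕ, 0 < n → s ≠ ofNat n

/-- A sequence `b₀ ∣ b₁ ∣ b₂ ∣ ⋯` of divisors of `s` with least common multiple `s`. -/
structure DivisorChain (s : SteinitzNumber) where
  b : ℕ → ℕ
  mem : ∀ i, b i ∈ s.Ω
  dvd : ∀ i, b i ∣ b (i + 1)
  lcm : ∀ p : Nat.Primes, ⨆ i, ((b i).factorization p : ℕ∞) = s p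

lemma lcm_mem {s : SteinitzNumber} {k l : ℕ} (hk : k ∈ s.Ω) (hl : l ∈ s.Ω) : k.lcm l ∈ s.Ω := by
  refine ⟨Nat.lcm_pos hk.1 hl.1, fun p => ?_⟩
  rw [Nat.factorization_lcm hk.1.ne' hl.1.ne']
  simp only [Finsupp.sup_apply]
  rcases le_total (k.factorization p) (l.factorization p) with h | h
  · rw [sup_eq_right.2 h]; exact hl.2 p
  · rw [sup_eq_left.2 h]; exact hk.2 p

end SteinitzNumber

namespace MeasureAlgebra

open SteinitzNumber

lemma periodic_mul {a : ℕ → ZMod 2} {k : ℕ} (h : Function.Periodic a k) (m : ℕ) :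
    Function.Periodic a (m * k) := by
  simpa using h.nsmul m

lemma periodic_of_dvd {a : ℕ → ZMod 2} {k l : ℕ} (h : Function.Periodic a k) (hl : k ∣ l) :
    Function.Periodic a l := by
  obtain ⟨m, rfl⟩ := hl
  rw [mul_comm]
  exact periodic_mul h m

/-- The sequences of period `k`, for some positive integer `k` that divides `u`; equivalently,
the periodic sequences with minimal period dividing `u`. -/
def periodicSubalgebra (u : SteinitzNumber) : NonUnitalSubalgebra (ZMod 2) (ℕ → ZMod 2) where
  carrier := {a | ∃ k ∈ u.Ω, Function.Periodic a k}
  add_mem' := by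
    rintro a b ⟨k, hk, ha⟩ ⟨l, hl, hb⟩
    exact ⟨k.lcm l, lcm_mem hk hl,
      (periodic_of_dvd ha (Nat.dvd_lcm_left k l)).add (periodic_of_dvd hb (Nat.dvd_lcm_right k l))⟩
  zero_mem' := ⟨1, ⟨one_pos, fun p => by simp⟩, fun _ => rfl⟩
  mul_mem' := by
    rintro a b ⟨k, hk, ha⟩ ⟨l, hl, hb⟩
    exact ⟨k.lcm l, lcm_mem hk hl,
      (periodic_of_dvd ha (Nat.dvd_lcm_left k l)).mul (periodic_of_dvd hb (Nat.dvd_lcm_right k l))⟩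
  smul_mem' := by
    rintro c a ⟨k, hk, ha⟩
    exact ⟨k, hk, ha.smul c⟩

/-- The average of the first `k` terms of a sequence. -/
def mean (a : ℕ → ZMod 2) (k : ℕ) : ℝ := (∑ i ∈ Finset.range k, ((a i).val : ℝ)) / k

lemma sum_range_mul (f : ℕ → ℝ) (k N : ℕ) :
    ∑ j ∈ Finset.range (N * k), f j = ∑ n ∈ Finset.range N, ∑ c ∈ Finset.range k, f (n * k + c) := by
  induction N with
  | zero => simp
  | succ N ih => rw [Nat.succ_mul, Finset.sum_range_add, ih, Finset.sum_range_succ]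

lemma mean_mul {a : ℕ → ZMod 2} {k : ℕ} (h : Function.Periodic a k) {m : ℕ} (hm : 0 < m) :
    mean a (m * k) = mean a k := by
  have hm' : (m : ℝ) ≠ 0 := by positivity
  unfold mean
  rw [sum_range_mul]
  have : ∀ n c, a (n * k + c) = a c := fun n c => by
    rw [add_comm]; exact periodic_mul h n c
  simp only [this, Finset.sum_const, Finset.card_range, nsmul_eq_mul]
  push_cast
  rw [mul_div_mul_left _ _ hm']

lemma mean_eq {a : ℕ → ZMod 2} {k l : ℕ} (hk : 0 < k) (hl : 0 < l)
    (h : Function.Periodic a k) (h' : Function.Periodic a l) : mean a k = mean a l := by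
  rw [← mean_mul h hl, ← mean_mul h' hk, mul_comm]

lemma zmod_val_add {a b : ZMod 2} (h : a * b = 0) : (a + b).val = a.val + b.val := by
  revert a b; decide

/-- The measure algebra `H(u)` of the `u`-periodic sequences; the measure of a sequence of period
`k` is the average of its first `k` terms (for any choice of `k`, by `mean_eq`). -/
def Per (u : SteinitzNumber) : MeasureAlgebra.{0} where
  carrier := periodicSubalgebra u
  mul_self' x := Subtype.ext <| funext fun i => by
    have : ∀ z : ZMod 2, z * z = z := by decide
    exact this (x.1 i)
  μ x := mean x.1 x.2.choose
  nonneg' x := by unfold mean; positivity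
  eq_zero_iff' x := by
    have hk := x.2.choose_spec
    set k := x.2.choose
    have hk' : (k : ℝ) ≠ 0 := by exact_mod_cast hk.1.1.ne'
    unfold mean
    rw [div_eq_zero_iff, or_iff_left hk', Finset.sum_eq_zero_iff_of_nonneg (by intros; positivity)]
    simp only [Finset.mem_range, Nat.cast_eq_zero, ZMod.val_eq_zero]
    constructor
    · intro h
      refine Subtype.ext <| funext fun i => ?_
      have := h (i % k) (Nat.mod_lt _ hk.1.1)
      rwa [hk.2.map_mod_nat] at this
    · rintro rfl i -
      rfl
  add' x y h := by
    have hx := x.2.choose_spec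
    have hy := y.2.choose_spec
    have hxy := (x + y).2.choose_spec
    set k := x.2.choose
    set l := y.2.choose
    have hx' : Function.Periodic x.1 (k.lcm l) := periodic_of_dvd hx.2 (Nat.dvd_lcm_left k l)
    have hy' : Function.Periodic y.1 (k.lcm l) := periodic_of_dvd hy.2 (Nat.dvd_lcm_right k l)
    have h0 : 0 < k.lcm l := Nat.lcm_pos hx.1.1 hy.1.1
    rw [mean_eq hx.1.1 h0 hx.2 hx', mean_eq hy.1.1 h0 hy.2 hy',
      mean_eq hxy.1.1 h0 hxy.2 (hx'.add hy')]
    unfold mean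
    rw [← add_div, ← Finset.sum_add_distrib]
    congr 1
    refine Finset.sum_congr rfl fun i _ => ?_
    exact_mod_cast zmod_val_add (congrFun (congrArg Subtype.val h) i)

lemma Per_μ {u : SteinitzNumber} (a : Per u) {k : ℕ} (hk : 0 < k)
    (h : Function.Periodic a.1 k) : (Per u).μ a = mean a.1 k :=
  mean_eq a.2.choose_spec.1.1 hk a.2.choose_spec.2 h

lemma exists_period {u u' : SteinitzNumber} {k : ℕ} (hk : 0 < k)
    (hu : ∀ p, u p ≤ (k.factorization p : ℕ∞) + u' p) (a : Per u) :
    ∃ N ∈ u'.Ω, Function.Periodic a.1 (N * k) := by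
  obtain ⟨P, hP, ha⟩ := a.2
  obtain ⟨N, hN⟩ := Nat.dvd_lcm_right P k
  have hpos : 0 < P.lcm k := Nat.lcm_pos hP.1 hk
  have hN0 : 0 < N := Nat.pos_of_ne_zero fun h => by rw [h] at hN; omega
  refine ⟨N, ⟨hN0, fun p => ?_⟩, ?_⟩
  · have h1 : (P.lcm k).factorization p = k.factorization p + N.factorization p := by
      rw [hN, Nat.factorization_mul hk.ne' hN0.ne']; rfl
    rw [Nat.factorization_lcm hP.1.ne' hk.ne'] at h1
    simp only [Finsupp.sup_apply] at h1
    have h2 := (hP.2 p).trans (hu p)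
    rcases le_total (P.factorization p) (k.factorization p) with h | h
    · rw [sup_eq_right.2 h] at h1
      have : N.factorization p = 0 := by omega
      simp [this]
    · rw [sup_eq_left.2 h] at h1
      rw [h1, Nat.cast_add] at h2
      exact (ENat.add_le_add_iff_left (ENat.natCast_ne_top _)).1 h2
  · rw [mul_comm, ← hN]
    exact periodic_of_dvd ha (Nat.dvd_lcm_left P k)

/-- For `u = k * u'`, the map `H(u) → H(u')` taking `a` to the sequence `n ↦ a (n * k + c)`. -/
def decimate {u u' : SteinitzNumber} {k : ℕ} (hk : 0 < k)
    (hu : ∀ p, u p ≤ (k.factorization p : ℕ∞) + u' p) (c : ℕ) :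
    periodicSubalgebra u →ₗ[ZMod 2] periodicSubalgebra u' where
  toFun a := ⟨fun n => a.1 (n * k + c), by
    obtain ⟨N, hN, h⟩ := exists_period hk hu a
    refine ⟨N, hN, fun n => ?_⟩
    change a.1 ((n + N) * k + c) = a.1 (n * k + c)
    rw [← h (n * k + c), add_mul, add_right_comm]⟩
  map_add' a b := rfl
  map_smul' z a := rfl

/-- The map `𝔽₂ᵐ → 𝔽₂ᵐ'` placing the `p`-th coordinate at position `p * k + c`. -/
def place (m k m' c : ℕ) : (Fin m → ZMod 2) →ₗ[ZMod 2] (Fin m' → ZMod 2) where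
  toFun x q := if h : q.1 / k < m then (if q.1 % k = c then x ⟨q.1 / k, h⟩ else 0) else 0
  map_add' x y := by
    funext q
    simp only [Pi.add_apply]
    split_ifs <;> simp
  map_smul' z x := by
    funext q
    simp only [Pi.smul_apply, RingHom.id_apply]
    split_ifs <;> simp

lemma place_apply (m k m' c : ℕ) (x : Fin m → ZMod 2) (q : Fin m') : place m k m' c x q =
    if h : q.1 / k < m then (if q.1 % k = c then x ⟨q.1 / k, h⟩ else 0) else 0 := rfl

lemma place_mul (m k m' c : ℕ) (x y : Fin m → ZMod 2) :
    place m k m' c x * place m k m' c y = place m k m' c (x * y) := by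
  funext q
  simp only [Pi.mul_apply, place_apply]
  split_ifs <;> simp

lemma place_mul_ne (m k m' : ℕ) {c d : ℕ} (h : c ≠ d) (x y : Fin m → ZMod 2) :
    place m k m' c x * place m k m' d y = 0 := by
  funext q
  simp only [Pi.mul_apply, place_apply, Pi.zero_apply]
  split_ifs <;> first | omega | simp

lemma place_tmul_mul_ne (m k m' : ℕ) {c d : ℕ} (h : c ≠ d) (x y : Fin m → ZMod 2)
    {u : SteinitzNumber} (a b : periodicSubalgebra u) :
    (place m k m' c x ⊗ₜ[ZMod 2] a) * (place m k m' d y ⊗ₜ[ZMod 2] b) = 0 := by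
  rw [Algebra.TensorProduct.tmul_mul_tmul, place_mul_ne m k m' h, TensorProduct.zero_tmul]

lemma place_sum {m k m' c : ℕ} (hc : c < k) (hm : m * k ≤ m') (x : Fin m → ZMod 2) :
    ∑ q : Fin m', ((place m k m' c x q).val : ℝ) = ∑ p : Fin m, ((x p).val : ℝ) := by
  have hk : 0 < k := by omega
  have hlt : ∀ p : Fin m, p.1 * k + c < m' := fun p => by
    have : (p.1 + 1) * k ≤ m * k := Nat.mul_le_mul_right k p.2
    rw [Nat.succ_mul] at this
    omega
  have hdiv : ∀ p : ℕ, (p * k + c) / k = p := fun p => by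
    rw [mul_comm, Nat.mul_add_div hk, Nat.div_eq_of_lt hc, add_zero]
  have hmod : ∀ p : ℕ, (p * k + c) % k = c := fun p => by
    rw [mul_comm, Nat.mul_add_mod, Nat.mod_eq_of_lt hc]
  symm
  refine Finset.sum_of_injOn (fun p : Fin m => (⟨p.1 * k + c, hlt p⟩ : Fin m')) ?_
    (fun _ _ => Finset.mem_coe.2 (Finset.mem_univ _)) ?_ ?_
  · intro p _ q _ h
    have h1 := congrArg (fun z : Fin m' => z.1 / k) h
    simp only [hdiv] at h1
    exact Fin.ext h1
  · intro q _ hq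
    have : place m k m' c x q = 0 := by
      rw [place_apply]
      split_ifs with h1 h2
      · exfalso
        refine hq ⟨⟨q.1 / k, h1⟩, Finset.mem_coe.2 (Finset.mem_univ _), Fin.ext ?_⟩
        have := Nat.div_add_mod q.1 k
        simp only
        rw [mul_comm, ← h2]
        exact this
      · rfl
      · rfl
    rw [this]; simp
  · intro p _
    have : place m k m' c x ⟨p.1 * k + c, hlt p⟩ = x p := by
      rw [place_apply, dif_pos (by simp only [hdiv]; exact p.2), if_pos (hmod p)]
      congr 1
      exact Fin.ext (hdiv p)
    rw [this]

/-- The linear map underlying `step`. -/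
def stepLinear {u u' : SteinitzNumber} {k : ℕ} (hk : 0 < k)
    (hu : ∀ p, u p ≤ (k.factorization p : ℕ∞) + u' p) (m m' : ℕ) :
    (Fin m → ZMod 2) ⊗[ZMod 2] periodicSubalgebra u →ₗ[ZMod 2]
      (Fin m' → ZMod 2) ⊗[ZMod 2] periodicSubalgebra u' :=
  ∑ c ∈ Finset.range k, TensorProduct.map (place m k m' c) (decimate hk hu c)

lemma stepLinear_tmul {u u' : SteinitzNumber} {k : ℕ} (hk : 0 < k)
    (hu : ∀ p, u p ≤ (k.factorization p : ℕ∞) + u' p) (m m' : ℕ)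
    (x : Fin m → ZMod 2) (a : periodicSubalgebra u) :
    stepLinear hk hu m m' (x ⊗ₜ a) =
      ∑ c ∈ Finset.range k, place m k m' c x ⊗ₜ[ZMod 2] decimate hk hu c a := by
  simp only [stepLinear, LinearMap.sum_apply, TensorProduct.map_tmul]

lemma stepLinear_mul {u u' : SteinitzNumber} {k : ℕ} (hk : 0 < k)
    (hu : ∀ p, u p ≤ (k.factorization p : ℕ∞) + u' p) (m m' : ℕ)
    (t t' : (Fin m → ZMod 2) ⊗[ZMod 2] periodicSubalgebra u) :
    stepLinear hk hu m m' (t * t') = stepLinear hk hu m m' t * stepLinear hk hu m m' t' := by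
  induction t using TensorProduct.induction_on with
  | zero => simp
  | add a b ha hb => rw [add_mul, map_add, ha, hb, map_add, add_mul]
  | tmul x a =>
    induction t' using TensorProduct.induction_on with
    | zero => simp
    | add c d hc hd => rw [mul_add, map_add, hc, hd, map_add, mul_add]
    | tmul y b =>
      rw [Algebra.TensorProduct.tmul_mul_tmul, stepLinear_tmul, stepLinear_tmul, stepLinear_tmul,
        Finset.sum_mul]
      refine Finset.sum_congr rfl fun c hc => ?_
      rw [Finset.mul_sum, Finset.sum_eq_single c]
      · rw [Algebra.TensorProduct.tmul_mul_tmul, place_mul]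
        rfl
      · intro d _ hd
        rw [Algebra.TensorProduct.tmul_mul_tmul, place_mul_ne m k m' hd.symm,
          TensorProduct.zero_tmul]
      · exact fun h => absurd hc h

/-- The embedding of `St m ⊗ H(u)` into `St m' ⊗ H(u')`, where `u = k * u'` and `m * k ≤ m'`: it is
the composition of the isomorphism `H(u) ≅ St k ⊗ H(u')` that splits a sequence into its residue
classes modulo `k`, the isomorphism `St m ⊗ St k ≅ St (m * k)`, and the inclusion of
`St (m * k)` into `St m'` as the first `m * k` coordinates. -/
def step {u u' : SteinitzNumber} {k : ℕ} (hk : 0 < k)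
    (hu : ∀ p, u p ≤ (k.factorization p : ℕ∞) + u' p) (m m' : ℕ) :
    tensor (St m) (Per u) →ₙₐ[ZMod 2] tensor (St m') (Per u') where
  toFun := stepLinear hk hu m m'
  map_smul' z t := map_smul (stepLinear hk hu m m') z t
  map_zero' := map_zero (stepLinear hk hu m m')
  map_add' t t' := map_add (stepLinear hk hu m m') t t'
  map_mul' t t' := stepLinear_mul hk hu m m' t t'

lemma sum_decimate {u u' : SteinitzNumber} {k : ℕ} (hk : 0 < k)
    (hu : ∀ p, u p ≤ (k.factorization p : ℕ∞) + u' p) (a : Per u) :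
    ∑ c ∈ Finset.range k, (Per u').μ (decimate hk hu c a) = k * (Per u).μ a := by
  obtain ⟨N, hN, h⟩ := exists_period hk hu a
  have hN' : (N : ℝ) ≠ 0 := by exact_mod_cast hN.1.ne'
  have hk' : (k : ℝ) ≠ 0 := by exact_mod_cast hk.ne'
  have h1 : ∀ c, (Per u').μ (decimate hk hu c a) = mean (fun n => a.1 (n * k + c)) N := fun c => by
    refine Per_μ _ hN.1 fun n => ?_
    change a.1 ((n + N) * k + c) = a.1 (n * k + c)
    rw [← h (n * k + c), add_mul, add_right_comm]
  rw [Finset.sum_congr rfl fun c _ => h1 c, Per_μ a (Nat.mul_pos hN.1 hk) h]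
  unfold mean
  rw [sum_range_mul, ← Finset.sum_div, Finset.sum_comm]
  push_cast
  field_simp

lemma step_μ {u u' : SteinitzNumber} {k : ℕ} (hk : 0 < k)
    (hu : ∀ p, u p ≤ (k.factorization p : ℕ∞) + u' p) {m m' : ℕ} (hm : m * k ≤ m')
    (t : tensor (St m) (Per u)) :
    m' * (tensor (St m') (Per u')).μ (step hk hu m m' t) =
      k * (m * (tensor (St m) (Per u)).μ t) := by
  refine congrFun (tensor_ext (m := fun t => m' * (tensor (St m') (Per u')).μ (step hk hu m m' t))
    (m' := fun t => k * (m * (tensor (St m) (Per u)).μ t)) ?_ ?_ ?_) t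
  · intro x y hxy
    rw [map_add, MeasureAlgebra.add', mul_add]
    rw [← map_mul, hxy, map_zero]
  · intro x y hxy
    rw [MeasureAlgebra.add' _ _ _ hxy]; ring
  · intro x a
    have e : step hk hu m m' (x ⊗ₜ[ZMod 2] a) = ∑ c ∈ Finset.range k,
        (id (place m k m' c x ⊗ₜ[ZMod 2] decimate hk hu c a) : tensor (St m') (Per u')) :=
      stepLinear_tmul hk hu m m' x a
    have h2 : (tensor (St m) (Per u)).μ (x ⊗ₜ[ZMod 2] a) =
        (∑ p : Fin m, ((x p).val : ℝ)) / m * (Per u).μ a := tensorμ_tmul x a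
    have h1 : ∀ c ∈ Finset.range k, (tensor (St m') (Per u')).μ
        (id (place m k m' c x ⊗ₜ[ZMod 2] decimate hk hu c a) : tensor (St m') (Per u')) =
        (∑ p : Fin m, ((x p).val : ℝ)) / m' * (Per u').μ (decimate hk hu c a) := fun c hc => by
      refine (tensorμ_tmul (A := St m') (B := Per u') (place m k m' c x)
        (decimate hk hu c a)).trans ?_
      exact congrArg (· / (m' : ℝ) * (Per u').μ (decimate hk hu c a))
        (place_sum (Finset.mem_range.1 hc) hm x)
    rw [e, μ_sum, Finset.sum_congr rfl h1, ← Finset.mul_sum, sum_decimate, h2]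
    · rcases Nat.eq_zero_or_pos m with rfl | hm0
      · simp
      · have hm1 : 0 < m' := lt_of_lt_of_le (Nat.mul_pos hm0 hk) hm
        field_simp
    · intro c _ d _ hcd
      exact place_tmul_mul_ne m k m' hcd x x (decimate hk hu c a) (decimate hk hu d a)

end MeasureAlgebra

namespace MeasureAlgebra

open SteinitzNumber

section Union

variable (G : ℕ → MeasureAlgebra.{u}) (f : ∀ i, G i →ₙₐ[ZMod 2] G (i + 1))

/-- The composition `G i → G (i + 1) → ⋯ → G j`. -/
def transition (i j : ℕ) (h : i ≤ j) : G i →ₙₐ[ZMod 2] G j :=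
  Nat.leRec (motive := fun k _ => G i →ₙₐ[ZMod 2] G k) (NonUnitalAlgHom.id (ZMod 2) (G i))
    (fun k _ g => (f k).comp g) h

lemma transition_self (i : ℕ) (x : G i) : transition G f i i le_rfl x = x := by
  unfold transition
  rw [Nat.leRec_self]
  rfl

lemma transition_succ {i j : ℕ} (h : i ≤ j) (x : G i) :
    transition G f i (j + 1) (Nat.le_succ_of_le h) x = f j (transition G f i j h x) := by
  unfold transition
  rw [Nat.leRec_succ _ _ h]
  rfl

instance : DirectedSystem (fun i => (G i : Type u)) (fun i j h => transition G f i j h) where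
  map_self i x := transition_self G f i x
  map_map k j i hij hjk x := by
    induction k, hjk using Nat.le_induction with
    | base => exact transition_self G f j _
    | succ k hjk ih =>
      rw [transition_succ G f hjk, transition_succ G f (hij.trans hjk), ih]

variable {G f} in
lemma transition_μ {c : ℕ → ℝ}
    (hc : ∀ i (x : G i), c (i + 1) * (G (i + 1)).μ (f i x) = c i * (G i).μ x)
    {i j : ℕ} (hij : i ≤ j) (x : G i) :
    c j * (G j).μ (transition G f i j hij x) = c i * (G i).μ x := by
  induction j, hij using Nat.le_induction with
  | base => rw [transition_self]
  | succ j hij ih => rw [transition_succ G f hij, hc, ← ih]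

/-- The union of a chain `G 0 → G 1 → ⋯` of measure algebras whose measures agree along the chain
up to the factors `c i`, with the measure that is `c i * μ` on `G i`. -/
def union (c : ℕ → ℝ) (hc0 : ∀ i, 0 ≤ c i) (hc1 : ∀ i (x : G i), c i * (G i).μ x = 0 → x = 0)
    (hc : ∀ i (x : G i), c (i + 1) * (G (i + 1)).μ (f i x) = c i * (G i).μ x) :
    MeasureAlgebra.{u} where
  carrier := DirectLimit (fun i => (G i : Type u)) (transition G f)
  mul_self' := DirectLimit.induction _ fun i x => by
    rw [DirectLimit.mul_def, (G i).mul_self']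
  μ := DirectLimit.lift (transition G f) (fun i x => c i * (G i).μ x) fun i j hij x =>
    (transition_μ hc hij x).symm
  nonneg' := DirectLimit.induction _ fun i x => by
    rw [DirectLimit.lift_def]
    exact mul_nonneg (hc0 i) ((G i).nonneg' x)
  eq_zero_iff' := DirectLimit.induction _ fun i x => by
    rw [DirectLimit.lift_def]
    constructor
    · intro h
      rw [hc1 i x h, ← DirectLimit.zero_def]
    · intro h
      obtain ⟨j, hij, hx⟩ := (DirectLimit.exists_eq_zero (f := transition G f) ⟨i, x⟩).1 h
      rw [← transition_μ hc hij x, hx, μ_zero, mul_zero]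
  add' := DirectLimit.induction₂ _ fun i x y h => by
    rw [DirectLimit.add_def, DirectLimit.lift_def, DirectLimit.lift_def, DirectLimit.lift_def]
    rw [DirectLimit.mul_def] at h
    obtain ⟨j, hij, hx⟩ := (DirectLimit.exists_eq_zero (f := transition G f) ⟨i, x * y⟩).1 h
    have hxy : x * y = 0 := hc1 i _ (by rw [← transition_μ hc hij (x * y), hx, μ_zero, mul_zero])
    rw [(G i).add' x y hxy, mul_add]

end Union

lemma eq_zero_of_scaled {m b : ℕ} (hb : 0 < b) {u : SteinitzNumber} (t : tensor (St m) (Per u))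
    (h : (m : ℝ) / b * (tensor (St m) (Per u)).μ t = 0) : t = 0 := by
  rw [← (tensor (St m) (Per u)).eq_zero_iff']
  rcases Nat.eq_zero_or_pos m with rfl | hm
  · obtain ⟨ι, _, a, d, had⟩ := exists_rep (A := St 0) (B := Per u) t
    refine had.tensorμ_eq.trans (Finset.sum_eq_zero fun i _ => ?_)
    rw [show (St 0).μ (a i) = 0 from div_eq_zero_iff.2 (Or.inr Nat.cast_zero), zero_mul]
  · exact (mul_eq_zero.1 h).resolve_left (by positivity)

lemma DivisorChain.mul_div {s : SteinitzNumber} (ch : DivisorChain s) (i : ℕ) :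
    ch.b i * (ch.b (i + 1) / ch.b i) = ch.b (i + 1) := Nat.mul_div_cancel' (ch.dvd i)

lemma DivisorChain.div_pos {s : SteinitzNumber} (ch : DivisorChain s) (i : ℕ) :
    0 < ch.b (i + 1) / ch.b i :=
  Nat.div_pos (Nat.le_of_dvd (ch.mem (i + 1)).1 (ch.dvd i)) (ch.mem i).1

lemma DivisorChain.quot_le {s : SteinitzNumber} (ch : DivisorChain s) (i : ℕ) (p : Nat.Primes) :
    s.quot (ch.b i) p ≤
      ((ch.b (i + 1) / ch.b i).factorization p : ℕ∞) + s.quot (ch.b (i + 1)) p := by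
  have h : (ch.b (i + 1)).factorization p =
      (ch.b i).factorization p + (ch.b (i + 1) / ch.b i).factorization p := by
    conv_lhs => rw [← DivisorChain.mul_div ch i]
    rw [Nat.factorization_mul (ch.mem i).1.ne' (DivisorChain.div_pos ch i).ne']
    rfl
  unfold SteinitzNumber.quot
  rw [h, Nat.cast_add, ← tsub_tsub]
  exact le_add_tsub

/-- For a sequence `b₀ ∣ b₁ ∣ ⋯` of divisors of `s` with least common multiple `s`, and integers
`mᵢ` with `mᵢ * (bᵢ₊₁ / bᵢ) ≤ mᵢ₊₁`, the union of the measure algebras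
`Mᵢ = St mᵢ ⊗ H(s / bᵢ)`, where `Mᵢ` is embedded into `Mᵢ₊₁` as a corner by `step`. The measure of
the union is `mᵢ / bᵢ` times the measure of `Mᵢ`. -/
def cornerUnion {s : SteinitzNumber} (ch : DivisorChain s) (m : ℕ → ℕ)
    (hm : ∀ i, m i * (ch.b (i + 1) / ch.b i) ≤ m (i + 1)) : MeasureAlgebra.{0} :=
  union (fun i => tensor (St (m i)) (Per (s.quot (ch.b i))))
    (fun i => step (DivisorChain.div_pos ch i) (DivisorChain.quot_le ch i) (m i) (m (i + 1)))
    (fun i => (m i : ℝ) / ch.b i) (fun i => by positivity)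
    (fun i x h => eq_zero_of_scaled (ch.mem i).1 x h)
    (fun i x => by
      have h0 : (ch.b i : ℝ) ≠ 0 := by exact_mod_cast (ch.mem i).1.ne'
      have h1 : ((ch.b (i + 1) / ch.b i : ℕ) : ℝ) ≠ 0 := by
        exact_mod_cast (DivisorChain.div_pos ch i).ne'
      have h2 : (ch.b (i + 1) : ℝ) = ch.b i * ((ch.b (i + 1) / ch.b i : ℕ) : ℝ) := by
        exact_mod_cast (DivisorChain.mul_div ch i).symm
      rw [div_mul_eq_mul_div, step_μ _ _ (hm i), h2]
      field_simp)

/-- The integers `mᵢ = [r bᵢ]`. -/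
def mClosed (r : ℝ) (b : ℕ) : ℕ := ⌊r * b⌋₊

open Classical in
/-- The integers `mᵢ = [r bᵢ]` if `r bᵢ` is not an integer, and `mᵢ = r bᵢ - 1` if it is. -/
def mOpen (r : ℝ) (b : ℕ) : ℕ := if ∃ n : ℕ, r * b = n then ⌊r * b⌋₊ - 1 else ⌊r * b⌋₊

lemma mClosed_le (r : ℝ) (b k : ℕ) : mClosed r b * k ≤ mClosed r (b * k) := by
  unfold mClosed
  rcases le_or_gt r 0 with hr | hr
  · rw [Nat.floor_of_nonpos (mul_nonpos_of_nonpos_of_nonneg hr (by positivity)), zero_mul]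
    exact Nat.zero_le _
  · refine Nat.le_floor ?_
    have := Nat.floor_le (a := r * b) (by positivity)
    push_cast
    rw [← mul_assoc]
    gcongr

lemma mOpen_le (r : ℝ) (b : ℕ) {k : ℕ} (hk : 0 < k) : mOpen r b * k ≤ mOpen r (b * k) := by
  have hc := mClosed_le r b k
  have hk' : (0 : ℝ) < k := by exact_mod_cast hk
  unfold mClosed at hc
  unfold mOpen
  split_ifs with h1 h2 h2
  · rw [Nat.sub_mul]
    omega
  · obtain ⟨n, hn⟩ := h1
    exact absurd ⟨n * k, by push_cast; rw [← mul_assoc, hn]⟩ h2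
  · obtain ⟨n, hn⟩ := h2
    rcases le_or_gt r 0 with hr | hr
    · rw [Nat.floor_of_nonpos (mul_nonpos_of_nonpos_of_nonneg hr (by positivity)), zero_mul]
      exact Nat.zero_le _
    have hlt : ((⌊r * b⌋₊ : ℕ) : ℝ) < r * b :=
      lt_of_le_of_ne (Nat.floor_le (by positivity)) fun h => h1 ⟨_, h.symm⟩
    have hlt' : ((⌊r * b⌋₊ * k : ℕ) : ℝ) < n := by
      rw [← hn]
      push_cast
      rw [← mul_assoc]
      exact mul_lt_mul_of_pos_right hlt hk'
    have : ⌊r * b⌋₊ * k < n := by exact_mod_cast hlt'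
    rw [hn, Nat.floor_natCast]
    omega
  · exact hc

/-- The measure algebra `H(r, s)`, constructed from a chain of divisors of `s`. -/
def Hrs (r : ℝ) {s : SteinitzNumber} (ch : DivisorChain s) : MeasureAlgebra.{0} :=
  cornerUnion ch (fun i => mClosed r (ch.b i)) fun i => by
    have h := mClosed_le r (ch.b i) (ch.b (i + 1) / ch.b i)
    rwa [DivisorChain.mul_div] at h

/-- The measure algebra `H⁺(r, s)`, constructed from a chain of divisors of `s`. -/
def HrsPlus (r : ℝ) {s : SteinitzNumber} (ch : DivisorChain s) : MeasureAlgebra.{0} :=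
  cornerUnion ch (fun i => mOpen r (ch.b i)) fun i => by
    have h := mOpen_le r (ch.b i) (DivisorChain.div_pos ch i)
    rwa [DivisorChain.mul_div] at h

end MeasureAlgebra

/-- The entries of the list: `St n`; `H(∞) ⊗ H(s)`; `H(r, s)`; `H⁺(r, s)`. -/
inductive ListEntry : Type
  | st (n : ℕ) (hn : 1 ≤ n)
  | inf (s : SteinitzNumber)
  | closed (r : ℝ) (hr : 1 ≤ r) (s : SteinitzNumber) (hs : s.IsInfinite) (ch : s.DivisorChain)
  | plus (r : ℝ) (hr : 1 ≤ r) (s : SteinitzNumber) (hs : s.IsInfinite) (ch : s.DivisorChain)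

namespace ListEntry

open MeasureAlgebra SteinitzNumber

/-- The measure algebra of a list entry. -/
def algebra : ListEntry → MeasureAlgebra.{0}
  | st n _ => St n
  | inf s => tensor Hinf (Per s)
  | closed r _ _ _ ch => Hrs r ch
  | plus r _ _ _ ch => HrsPlus r ch

/-- `q * s' = s` and `r' = q * r` for the rational number `q = u / v`. -/
def Rescale (r : ℝ) (s : SteinitzNumber) (r' : ℝ) (s' : SteinitzNumber) : Prop :=
  ∃ u v : ℕ, 0 < u ∧ 0 < v ∧ ofNat v * s = ofNat u * s' ∧ v * r' = u * r

/-- The identifications between the parameters of the list entries. The choice of the chain of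
divisors does not matter; `H(r, s)` and `H⁺(r, s)` agree exactly if `r` is not a fraction with
denominator dividing `s`. -/
def Same : ListEntry → ListEntry → Prop
  | st n _, st n' _ => n = n'
  | inf s, inf s' => ∃ u v : ℕ, 0 < u ∧ 0 < v ∧ ofNat v * s = ofNat u * s'
  | closed r _ s _ _, closed r' _ s' _ _ => Rescale r s r' s'
  | plus r _ s _ _, plus r' _ s' _ _ => Rescale r s r' s'
  | closed r _ s _ _, plus r' _ s' _ _ =>
      Rescale r s r' s' ∧ ∀ a : ℕ, ∀ b ∈ s.Ω, r ≠ (a : ℝ) / b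
  | plus r _ s _ _, closed r' _ s' _ _ =>
      Rescale r s r' s' ∧ ∀ a : ℕ, ∀ b ∈ s.Ω, r ≠ (a : ℝ) / b
  | _, _ => False

end ListEntry

end

/-! The set of values D = μ(H) is a complete invariant: two countable locally standard measure
algebras are scalar equivalent with factor α exactly if D' = αD. This reduces the theorem to the
arithmetic of certain sets of real numbers.

Completeness of the invariant is a back-and-forth argument (`scalarEquiv_of_range_μ`). Any two
elements of a locally standard algebra are sums over subsets of one orthogonal family whose members
all have the same measure ε. Counting members shows that below b every value not exceeding μ(b) is
attained (`LocallyStandard.exists_le`), and that disjointly from b every nonnegative difference μ(c)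
- μ(b) is attained (`LocallyStandard.exists_orth`). Hence a finite partial isomorphism extends to
any further element on either side.

For the classification, scale D so that 1 ∈ D. The b with 1/b ∈ D are closed under divisors, and any
two of them have a common multiple of the same kind, so they are the divisors of a Steinitz number
s, and D is an initial segment of the fractions a/b with b ∈ Ω(s) (`IsValueSet.exists_steinitz`,
`IsValueSet.div_mem`). If D is unbounded, it consists of all these fractions and belongs to H(∞) ⊗
H(s). If D is bounded and s is an integer, D is finite and belongs to some St m. If D is bounded and
s is infinite, D is cut off at r = sup D, with H(r,s) or H⁺(r,s) according to whether r is attained.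

The value sets of the list are computed from families of equal measure, which pass through tensor
products and unions (`HasStdFamilies`). It remains to decide when two such sets are proportional. A
factor that matches the fractions of s with those of s' is some u/v with vs = us', it carries the
supremum r to r', and the closed and the open cutoff differ only by the point r, if r is a fraction
at all. -/

namespace MeasureAlgebra

/-! ### Orthogonal families of equal measure -/

section Families

variable {H : MeasureAlgebra.{u}} {ι : Type}

/-- A family of pairwise orthogonal elements that all have the measure `ε`. -/
structure IsStdFamily (e : ι → H) (ε : ℝ) : Prop where
  orth : ∀ i j, i ≠ j → e i * e j = 0
  meas : ∀ i, H.μ (e i) = ε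

/-- The coefficients are 0 or 1, so spans consist of subset sums, and measures become cardinalities
of index sets. -/
lemma mem_span_range_iff_exists_finset {M : Type*} [AddCommGroup M] [Module (ZMod 2) M]
    [Finite ι] {e : ι → M} {x : M} :
    x ∈ Submodule.span (ZMod 2) (Set.range e) ↔ ∃ T : Finset ι, ∑ i ∈ T, e i = x := by
  classical
  cases nonempty_fintype ι
  constructor
  · rw [Submodule.mem_span_range_iff_exists_fun]
    rintro ⟨c, rfl⟩
    refine ⟨Finset.univ.filter fun i => c i ≠ 0, ?_⟩
    rw [Finset.sum_filter]
    refine Finset.sum_congr rfl fun i _ => ?_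
    have : ∀ z : ZMod 2, z = 0 ∨ z = 1 := by decide
    rcases this (c i) with h | h <;> simp [h]
  · rintro ⟨T, rfl⟩
    exact Submodule.sum_mem _ fun i _ => Submodule.subset_span ⟨i, rfl⟩

lemma sum_mul_sum_of_orth {R : Type*} [NonUnitalNonAssocSemiring R] [DecidableEq ι] {e : ι → R}
    (ho : ∀ i j, i ≠ j → e i * e j = 0) (hs : ∀ i, e i * e i = e i) (T T' : Finset ι) :
    (∑ i ∈ T, e i) * ∑ i ∈ T', e i = ∑ i ∈ T ∩ T', e i := by
  rw [Finset.sum_mul, ← Finset.sum_ite_mem]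
  refine Finset.sum_congr rfl fun i _ => ?_
  rw [Finset.mul_sum]
  split_ifs with h
  · rw [Finset.sum_eq_single_of_mem i h fun j _ hj => ho i j hj.symm, hs]
  · exact Finset.sum_eq_zero fun j hj => ho i j (by rintro rfl; exact h hj)

lemma IsStdFamily.μ_sum {e : ι → H} {ε : ℝ} (h : IsStdFamily e ε) (T : Finset ι) :
    H.μ (∑ i ∈ T, e i) = T.card * ε := by
  rw [MeasureAlgebra.μ_sum _ _ fun i _ j _ hij => h.orth i j hij, Finset.sum_congr rfl
    fun i _ => h.meas i, Finset.sum_const, nsmul_eq_mul]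

lemma IsStdFamily.reindex {κ : Type} {e : ι → H} {ε : ℝ} (h : IsStdFamily e ε) (σ : κ ≃ ι) :
    IsStdFamily (e ∘ σ) ε :=
  ⟨fun _ _ hij => h.orth _ _ (σ.injective.ne hij), fun _ => h.meas _⟩

/-- Every finite subset lies in the span of a family whose size and unit measure belong to `S`,
and all pairs in `S` occur. -/
structure HasStdFamilies (H : MeasureAlgebra.{u}) (S : Set (ℕ × ℝ)) : Prop where
  occurs : ∀ p ∈ S, ∃ e : Fin p.1 → H, IsStdFamily e p.2
  covers : ∀ F : Set H, F.Finite → ∃ p ∈ S, ∃ e : Fin p.1 → H, IsStdFamily e p.2 ∧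
    F ⊆ Submodule.span (ZMod 2) (Set.range e)

lemma exists_stdFamily_fin [Fintype ι] {e : ι → H} {ε : ℝ} (h : IsStdFamily e ε) {n : ℕ}
    (hn : Fintype.card ι = n) : ∃ e' : Fin n → H, IsStdFamily e' ε ∧ Set.range e' = Set.range e :=
  ⟨e ∘ (Fintype.equivFinOfCardEq hn).symm, h.reindex _, EquivLike.range_comp e _⟩

/-- An element covered by a family of size n and measure ε is the sum of k ≤ n members and has
measure kε; conversely each k ≤ n is the size of some subfamily. -/
lemma HasStdFamilies.range_μ {S : Set (ℕ × ℝ)} (h : HasStdFamilies H S) :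
    Set.range H.μ = {x | ∃ p ∈ S, ∃ k ≤ p.1, x = k * p.2} := by
  ext x
  constructor
  · rintro ⟨a, rfl⟩
    obtain ⟨p, hp, e, he, hF⟩ := h.covers {a} (Set.finite_singleton a)
    obtain ⟨T, rfl⟩ := mem_span_range_iff_exists_finset.1 (hF rfl)
    exact ⟨p, hp, T.card, by simpa using T.card_le_univ, he.μ_sum T⟩
  · rintro ⟨p, hp, k, hk, rfl⟩
    obtain ⟨e, he⟩ := h.occurs p hp
    obtain ⟨T, -, rfl⟩ := Finset.exists_subset_card_eq (s := (Finset.univ : Finset (Fin p.1)))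
      (n := k) (by simpa using hk)
    exact ⟨_, he.μ_sum T⟩

lemma HasStdFamilies.locallyStandard {S : Set (ℕ × ℝ)} (h : HasStdFamilies H S) {z : H}
    (hz : z ≠ 0) : H.LocallyStandard := by
  classical
  intro F hF
  -- Covering the nonzero `z` together with `F` excludes the degenerate families with n = 0 or ε =
  -- 0.
  obtain ⟨⟨n, ε⟩, -, e, he, hs⟩ := h.covers (insert z F) (hF.insert z)
  simp only at e he hs
  have hε : 0 < ε := by
    obtain ⟨T, hT⟩ := mem_span_range_iff_exists_finset.1 (hs (Set.mem_insert z F))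
    have h1 := he.μ_sum T
    rw [hT] at h1
    have h2 : 0 < H.μ z := lt_of_le_of_ne (H.nonneg' z) fun h => hz ((H.eq_zero_iff' z).1 h.symm)
    rw [h1] at h2
    exact pos_of_mul_pos_right h2 (by positivity)
  have hn : 0 < n := by
    rcases Nat.eq_zero_or_pos n with rfl | hn
    · obtain ⟨T, hT⟩ := mem_span_range_iff_exists_finset.1 (hs (Set.mem_insert z F))
      exact absurd hT.symm (by rw [Subsingleton.elim T ∅]; simpa using hz)
    · exact hn
  let K : NonUnitalSubalgebra (ZMod 2) H :=
    { Submodule.span (ZMod 2) (Set.range e) with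
      mul_mem' := fun {a b} ha hb => by
        obtain ⟨T, rfl⟩ := mem_span_range_iff_exists_finset.1 ha
        obtain ⟨T', rfl⟩ := mem_span_range_iff_exists_finset.1 hb
        rw [sum_mul_sum_of_orth he.orth fun i => H.mul_self' _]
        exact mem_span_range_iff_exists_finset.2 ⟨_, rfl⟩ }
  have hK : ∀ x, x ∈ K ↔ x ∈ Submodule.span (ZMod 2) (Set.range e) := fun x => Iff.rfl
  have hval : ∀ x y : Fin n → ZMod 2, (∑ i, x i • e i) * (∑ i, y i • e i) =
      ∑ i, (x * y) i • e i := fun x y => by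
    rw [Finset.sum_mul]
    refine Finset.sum_congr rfl fun i _ => ?_
    rw [Finset.mul_sum, Finset.sum_eq_single i]
    · rw [smul_mul_smul_comm, H.mul_self']; rfl
    · intro j _ hj
      rw [smul_mul_smul_comm, he.orth i j hj.symm, smul_zero]
    · simp
  have hμ : ∀ x : Fin n → ZMod 2, H.μ (∑ i, x i • e i) = (∑ i, ((x i).val : ℝ)) * ε := fun x => by
    rw [MeasureAlgebra.μ_sum, Finset.sum_mul]
    · refine Finset.sum_congr rfl fun i _ => ?_
      have : ∀ z : ZMod 2, z = 0 ∨ z = 1 := by decide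
      rcases this (x i) with h | h
      · simp [h, μ_zero]
      · simp [h, he.meas, ZMod.val_one]
    · intro i _ j _ hij
      rw [smul_mul_smul_comm, he.orth i j hij, smul_zero]
  let ψ : (Fin n → ZMod 2) →ₙ+* K :=
    { toFun := fun x => ⟨∑ i, x i • e i, (hK _).2 <| Submodule.sum_mem _ fun i _ =>
        Submodule.smul_mem _ _ (Submodule.subset_span ⟨i, rfl⟩)⟩
      map_zero' := Subtype.ext (by simp)
      map_add' := fun x y => Subtype.ext (by simp [add_smul, Finset.sum_add_distrib])
      map_mul' := fun x y => Subtype.ext (hval x y).symm }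
  have hψμ : ∀ x, H.μ (ψ x) = n * ε * (St n).μ x := fun x => by
    refine (hμ x).trans ?_
    have : (n : ℝ) ≠ 0 := by positivity
    change _ = n * ε * ((∑ i, ((x i).val : ℝ)) / n)
    field_simp
  have hbij : Function.Bijective ψ := by
    constructor
    · rw [injective_iff_map_eq_zero]
      intro x hx
      have h1 := hψμ x
      rw [hx] at h1
      refine ((St n).eq_zero_iff' x).1 ?_
      have h2 : (n : ℝ) * ε ≠ 0 := by positivity
      have h3 : H.μ ((0 : K) : H) = 0 := H.μ_zero
      rw [h3] at h1
      exact (mul_eq_zero.1 h1.symm).resolve_left h2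
    · rintro ⟨x, hx⟩
      obtain ⟨c, hc⟩ := (Submodule.mem_span_range_iff_exists_fun _).1 ((hK x).1 hx)
      exact ⟨c, Subtype.ext hc⟩
  -- The whole family has measure nε, while the unit of `St n` has measure 1.
  refine ⟨K, fun x hx => hs (Set.mem_insert_of_mem z hx), n, hn, ((n : ℝ) * ε)⁻¹, by positivity,
    (RingEquiv.ofBijective ψ hbij).symm, fun a => ?_⟩
  obtain ⟨x, rfl⟩ := (RingEquiv.ofBijective ψ hbij).surjective a
  have h1 : (H.restrict K).μ (RingEquiv.ofBijective ψ hbij x) = n * ε * (St n).μ x := hψμ x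
  rw [h1]
  have h2 : (RingEquiv.ofBijective ψ hbij).symm (RingEquiv.ofBijective ψ hbij x) = x :=
    RingEquiv.symm_apply_apply _ _
  have h3 : (n : ℝ) * ε ≠ 0 := by positivity
  refine (congrArg (St n).μ h2).trans ?_
  field_simp

lemma St_sum_apply {n : ℕ} {κ : Type} (T : Finset κ) (f : κ → St n) (j : Fin n) :
    (∑ i ∈ T, f i : St n) j = ∑ i ∈ T, (f i : Fin n → ZMod 2) j := by
  classical
  induction T using Finset.induction_on with
  | empty => rfl
  | insert a s ha ih =>
    rw [Finset.sum_insert ha, Finset.sum_insert ha, ← ih]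
    rfl

/-- The standard basis of `St n`. -/
def stBasis (n : ℕ) (i : Fin n) : St n := (Pi.single i 1 : Fin n → ZMod 2)

lemma exists_sum_stBasis {n : ℕ} (x : St n) : ∃ T : Finset (Fin n), ∑ i ∈ T, stBasis n i = x := by
  classical
  refine ⟨Finset.univ.filter (fun i => (x : Fin n → ZMod 2) i ≠ 0), funext fun j => ?_⟩
  refine (St_sum_apply _ _ j).trans ?_
  rw [Finset.sum_filter, Finset.sum_eq_single j]
  · have : ∀ z : ZMod 2, (if z ≠ 0 then (1 : ZMod 2) else 0) = z := by decide
    unfold stBasis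
    rw [Pi.single_eq_same]
    convert this (x j)
  · intro i _ hi
    split_ifs
    · exact Pi.single_eq_of_ne hi.symm _
    · rfl
  · simp

lemma stBasis_isStdFamily (n : ℕ) : IsStdFamily (stBasis n) (1 / n) := by
  refine ⟨fun i j hij => funext fun l => ?_, fun i => ?_⟩
  · change (Pi.single i 1 : Fin n → ZMod 2) l * (Pi.single j 1 : Fin n → ZMod 2) l = 0
    rcases eq_or_ne l i with rfl | h
    · simp [hij]
    · simp [h]
  · change (∑ j, (((Pi.single i 1 : Fin n → ZMod 2) j).val : ℝ)) / n = 1 / n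
    congr 1
    rw [Finset.sum_eq_single i]
    · simp [ZMod.val_one]
    · intro j _ hj
      simp [hj]
    · simp

/-- The standard basis of `St n` is pulled back along the scalar equivalence; its measure 1/n gets
divided by the factor α. -/
lemma LocallyStandard.exists_family (h : H.LocallyStandard) {F : Set H} (hF : F.Finite) :
    ∃ n : ℕ, 1 ≤ n ∧ ∃ ε : ℝ, 0 < ε ∧ ∃ e : Fin n → H, IsStdFamily e ε ∧
      F ⊆ Submodule.span (ZMod 2) (Set.range e) := by
  classical
  obtain ⟨K, hK, n, hn, α, hα, φ, hφ⟩ := h F hF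
  have hf := stBasis_isStdFamily n
  have hμ : ∀ x : St n, H.μ ((φ.symm x : H.restrict K) : K).1 = α⁻¹ * (St n).μ x := fun x => by
    have h1 := hφ (φ.symm x)
    rw [RingEquiv.apply_symm_apply] at h1
    rw [h1, inv_mul_cancel_left₀ hα.ne']
    rfl
  let g : St n →+ H :=
    { toFun := fun x => ((φ.symm x : H.restrict K) : K).1
      map_zero' := by rw [map_zero]; rfl
      map_add' := fun x y => by rw [map_add]; rfl }
  have hg : ∀ x y, g (x * y) = g x * g y := fun x y => by
    change ((φ.symm (x * y) : H.restrict K) : K).1 = _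
    rw [map_mul]
    rfl
  refine ⟨n, hn, α⁻¹ * (1 / n), by positivity, fun i => g (stBasis n i),
    ⟨fun i j hij => ?_, fun i => ?_⟩, fun x hx => ?_⟩
  · rw [← hg, hf.orth i j hij, map_zero]
  · rw [← hf.meas i]
    exact hμ _
  · refine mem_span_range_iff_exists_finset.2 ?_
    let y : H.restrict K := ⟨x, hK hx⟩
    obtain ⟨T, hT⟩ := exists_sum_stBasis (φ y)
    refine ⟨T, ?_⟩
    rw [← map_sum, hT]
    change ((φ.symm (φ y) : H.restrict K) : K).1 = x
    rw [RingEquiv.symm_apply_apply]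

lemma LocallyStandard.exists_common_family (h : H.LocallyStandard) (x y : H) :
    ∃ n : ℕ, 1 ≤ n ∧ ∃ ε : ℝ, 0 < ε ∧ ∃ e : Fin n → H, IsStdFamily e ε ∧
      ∃ T T' : Finset (Fin n), ∑ i ∈ T, e i = x ∧ ∑ i ∈ T', e i = y := by
  obtain ⟨n, hn, ε, hε, e, he, hF⟩ := h.exists_family (Set.toFinite {x, y})
  obtain ⟨T, hT⟩ := mem_span_range_iff_exists_finset.1 (hF (Set.mem_insert x _))
  obtain ⟨T', hT'⟩ := mem_span_range_iff_exists_finset.1 (hF (Set.mem_insert_of_mem x rfl))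
  exact ⟨n, hn, ε, hε, e, he, T, T', hT, hT'⟩

/-- In a common family `b` has at least as many members as `c`, so a subset of those of `b` of the
right size gives `y`. -/
lemma LocallyStandard.exists_le (h : H.LocallyStandard) {b c : H} (hcb : H.μ c ≤ H.μ b) :
    ∃ y, y * b = y ∧ H.μ y = H.μ c := by
  classical
  obtain ⟨n, -, ε, hε, e, he, T, T', rfl, rfl⟩ := h.exists_common_family b c
  rw [he.μ_sum, he.μ_sum] at hcb
  have hcard : T'.card ≤ T.card := by exact_mod_cast le_of_mul_le_mul_right hcb hε
  obtain ⟨U, hU, hU'⟩ := Finset.exists_subset_card_eq hcard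
  refine ⟨∑ i ∈ U, e i, ?_, ?_⟩
  · rw [sum_mul_sum_of_orth he.orth fun i => H.mul_self' _, Finset.inter_eq_left.2 hU]
  · rw [he.μ_sum, he.μ_sum, hU']

/-- Since `c` itself fits into the common family, the members outside `b` are numerous enough to
make up the difference. -/
lemma LocallyStandard.exists_orth (h : H.LocallyStandard) {b c : H} (hbc : H.μ b ≤ H.μ c) :
    ∃ z, z * b = 0 ∧ H.μ z = H.μ c - H.μ b := by
  classical
  obtain ⟨n, -, ε, hε, e, he, T, T', rfl, rfl⟩ := h.exists_common_family b c
  rw [he.μ_sum, he.μ_sum] at hbc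
  have hcard : T.card ≤ T'.card := by exact_mod_cast le_of_mul_le_mul_right hbc hε
  have h1 : T'.card - T.card ≤ Tᶜ.card := by
    rw [Finset.card_compl]
    exact Nat.sub_le_sub_right (Finset.card_le_univ T') _
  obtain ⟨U, hU, hU'⟩ := Finset.exists_subset_card_eq h1
  refine ⟨∑ i ∈ U, e i, ?_, ?_⟩
  · rw [sum_mul_sum_of_orth he.orth fun i => H.mul_self' _, Finset.disjoint_iff_inter_eq_empty.1,
      Finset.sum_empty]
    exact Finset.disjoint_left.2 fun i hi => Finset.mem_compl.1 (hU hi)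
  · rw [he.μ_sum, he.μ_sum, he.μ_sum, hU', Nat.cast_sub hcard, sub_mul]

end Families

end MeasureAlgebra

namespace MeasureAlgebra

/-! ### Back and forth: the value set determines the algebra -/

section BackAndForth

variable {H : MeasureAlgebra.{u}} {H' : MeasureAlgebra.{v}} {α : ℝ}

/-- A finite partial isomorphism multiplying the measure by `α`, given by its graph: the span of
finitely many pairwise orthogonal pairs `(a, b)` with `μ b = α * μ a`. -/
def IsPartialIso (α : ℝ) (R : Submodule (ZMod 2) (H × H')) : Prop :=
  ∃ (ι : Type) (_ : Fintype ι) (a : ι → H × H'), (∀ i j, i ≠ j → a i * a j = 0) ∧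
    (∀ i, H'.μ (a i).2 = α * H.μ (a i).1) ∧ R = Submodule.span (ZMod 2) (Set.range a)

lemma prod_mul_self (p : H × H') : p * p = p := Prod.ext (H.mul_self' _) (H'.mul_self' _)

lemma isPartialIso_bot : IsPartialIso α (⊥ : Submodule (ZMod 2) (H × H')) :=
  ⟨Empty, inferInstance, fun _ => 0, fun i => i.elim, fun i => i.elim, by
    rw [Set.range_eq_empty, Submodule.span_empty]⟩

lemma IsPartialIso.μ_eq {R : Submodule (ZMod 2) (H × H')} (h : IsPartialIso α R) {p : H × H'}
    (hp : p ∈ R) : H'.μ p.2 = α * H.μ p.1 := by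
  obtain ⟨ι, _, a, ho, hμ, rfl⟩ := h
  obtain ⟨T, rfl⟩ := mem_span_range_iff_exists_finset.1 hp
  rw [Prod.snd_sum, Prod.fst_sum, μ_sum, μ_sum, Finset.mul_sum]
  · exact Finset.sum_congr rfl fun i _ => hμ i
  · exact fun i _ j _ hij => congrArg Prod.fst (ho i j hij)
  · exact fun i _ j _ hij => congrArg Prod.snd (ho i j hij)

lemma IsPartialIso.mul_mem {R : Submodule (ZMod 2) (H × H')} (h : IsPartialIso α R) {p q : H × H'}
    (hp : p ∈ R) (hq : q ∈ R) : p * q ∈ R := by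
  classical
  obtain ⟨ι, _, a, ho, hμ, rfl⟩ := h
  obtain ⟨T, rfl⟩ := mem_span_range_iff_exists_finset.1 hp
  obtain ⟨T', rfl⟩ := mem_span_range_iff_exists_finset.1 hq
  rw [sum_mul_sum_of_orth ho fun i => prod_mul_self _]
  exact mem_span_range_iff_exists_finset.2 ⟨_, rfl⟩

lemma IsPartialIso.swap (hα : 0 < α) {R : Submodule (ZMod 2) (H × H')} (h : IsPartialIso α R) :
    IsPartialIso α⁻¹ (R.map (LinearEquiv.prodComm (ZMod 2) H H' : H × H' →ₗ[ZMod 2] H' × H)) := by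
  obtain ⟨ι, _, a, ho, hμ, rfl⟩ := h
  refine ⟨ι, inferInstance, fun i => (a i).swap, fun i j hij => ?_, fun i => ?_, ?_⟩
  · exact Prod.ext (congrArg Prod.snd (ho i j hij)) (congrArg Prod.fst (ho i j hij))
  · change H.μ (a i).1 = α⁻¹ * H'.μ (a i).2
    rw [hμ, inv_mul_cancel_left₀ hα.ne']
  · rw [Submodule.map_span, ← Set.range_comp]
    rfl

/-- Each `a i` is cut into `c i` and the rest, and one new element disjoint from all `a i` is added.
The ring is general because the lemma is applied to H × H', where it cuts both sides at once. -/
lemma orth_refine {R ι : Type*} [NonUnitalCommRing R] (hR : ∀ x : R, x * x = x) {a c : ι → R}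
    {z : R} (ha : ∀ i j, i ≠ j → a i * a j = 0) (hc : ∀ i, c i * a i = c i)
    (hz : ∀ i, z * a i = 0) (i j : ι ⊕ ι ⊕ Unit) (hij : i ≠ j) :
    Sum.elim c (Sum.elim (fun i => a i - c i) fun _ => z) i *
      Sum.elim c (Sum.elim (fun i => a i - c i) fun _ => z) j = 0 := by
  have hca : ∀ i j, i ≠ j → c i * a j = 0 := fun i j h => by
    rw [← hc i, mul_assoc, ha i j h, mul_zero]
  have hcc : ∀ i j, i ≠ j → c i * c j = 0 := fun i j h => by
    rw [← hc j, mul_left_comm, hca i j h, mul_zero]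
  have hzc : ∀ i, z * c i = 0 := fun i => by
    rw [← hc i, mul_left_comm, hz i, mul_zero]
  have hcd : ∀ i j, c i * (a j - c j) = 0 := fun i j => by
    rcases eq_or_ne i j with rfl | h
    · rw [mul_sub, hc, hR, sub_self]
    · rw [mul_sub, hca i j h, hcc i j h, sub_self]
  have hzd : ∀ i, z * (a i - c i) = 0 := fun i => by rw [mul_sub, hz, hzc, sub_self]
  rcases i with i | i | i <;> rcases j with j | j | j <;>
    simp only [Sum.elim_inl, Sum.elim_inr]
  · exact hcc i j fun h => hij (by rw [h])
  · exact hcd i j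
  · rw [mul_comm, hzc]
  · rw [mul_comm, hcd]
  · have h : i ≠ j := fun h => hij (by rw [h])
    rw [sub_mul, hcd, mul_sub, ha i j h, mul_comm, hca j i h.symm, sub_self, sub_self]
  · rw [mul_comm, hzd]
  · exact hzc j
  · exact hzd j
  · exact absurd rfl hij

lemma μ_mul_le (a x : H) : H.μ (a * x) ≤ H.μ a := by
  rw [μ_split a x]
  exact le_add_of_nonneg_right (H.nonneg' _)

/-- The element `x` cuts each block of the partial isomorphism in two and may stick out of their
union. The image blocks are cut in the same proportion by `exists_le`, and a partner of the
protruding part is found by `exists_orth`. -/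
lemma IsPartialIso.extend (hα : 0 < α) (hH' : H'.LocallyStandard)
    (hD : ∀ x : H, ∃ y : H', H'.μ y = α * H.μ x)
    {R : Submodule (ZMod 2) (H × H')} (h : IsPartialIso α R) (x : H) :
    ∃ R', IsPartialIso α R' ∧ R ≤ R' ∧ ∃ y, (x, y) ∈ R' := by
  have hR := h
  obtain ⟨ι, _, a, ho, hμ, rfl⟩ := h
  set A := ∑ i, a i with hA
  have haA : ∀ i, A * a i = a i := fun i => by
    classical
    rw [Finset.sum_mul, Finset.sum_eq_single i, prod_mul_self]
    · exact fun j _ hj => ho j i hj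
    · simp
  have hAmem : A ∈ Submodule.span (ZMod 2) (Set.range a) :=
    mem_span_range_iff_exists_finset.2 ⟨_, rfl⟩
  have hy : ∀ i, ∃ y : H', y * (a i).2 = y ∧ H'.μ y = α * H.μ ((a i).1 * x) := fun i => by
    obtain ⟨c, hc⟩ := hD ((a i).1 * x)
    rw [← hc]
    refine hH'.exists_le ?_
    rw [hc, hμ]
    exact mul_le_mul_of_nonneg_left (μ_mul_le _ _) hα.le
  choose y hy1 hy2 using hy
  have hort : A.1 * (x - x * A.1) = 0 := by
    rw [mul_sub, mul_comm x, ← mul_assoc, H.mul_self', sub_self]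
  -- The union of `A.1` and `x` has a measure whose α-fold is a value of H'; removing the measure of
  -- `A.2` from it leaves the required amount disjointly from `A.2`.
  obtain ⟨z, hz1, hz2⟩ : ∃ z : H', z * A.2 = 0 ∧ H'.μ z = α * H.μ (x - x * A.1) := by
    obtain ⟨c, hc⟩ := hD (A.1 + (x - x * A.1))
    rw [H.add' _ _ hort, mul_add, ← hR.μ_eq hAmem] at hc
    obtain ⟨z, hz1, hz2⟩ := hH'.exists_orth (b := A.2) (c := c) (by
      rw [hc]
      exact le_add_of_nonneg_right (mul_nonneg hα.le (H.nonneg' _)))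
    exact ⟨z, hz1, by rw [hz2, hc, add_sub_cancel_left]⟩
  let c : ι → H × H' := fun i => ((a i).1 * x, y i)
  let w : H × H' := (x - x * A.1, z)
  have hc : ∀ i, c i * a i = c i := fun i =>
    Prod.ext (by change (a i).1 * x * (a i).1 = (a i).1 * x; rw [mul_right_comm, H.mul_self'])
      (hy1 i)
  have hwA : w * A = 0 := Prod.ext ((mul_comm _ _).trans hort) hz1
  have hw : ∀ i, w * a i = 0 := fun i => by rw [← haA i, ← mul_assoc, hwA, zero_mul]
  let f : ι ⊕ ι ⊕ Unit → H × H' := Sum.elim c (Sum.elim (fun i => a i - c i) fun _ => w)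
  have hf : ∀ i, f i ∈ Submodule.span (ZMod 2) (Set.range f) := fun i =>
    Submodule.subset_span ⟨i, rfl⟩
  refine ⟨Submodule.span (ZMod 2) (Set.range f), ⟨_, inferInstance, f,
    orth_refine prod_mul_self ho hc hw, ?_, rfl⟩, ?_, (∑ i, c i + w).2, ?_⟩
  · rintro (i | i | i)
    · exact hy2 i
    · change H'.μ ((a i).2 - y i) = α * H.μ ((a i).1 - (a i).1 * x)
      have h1 := μ_split (a i).2 (y i)
      have h2 := μ_split (a i).1 x
      rw [mul_comm, hy1, hμ, h2, hy2] at h1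
      linarith
    · exact hz2
  · rw [Submodule.span_le]
    rintro _ ⟨i, rfl⟩
    have := Submodule.add_mem _ (hf (Sum.inl i)) (hf (Sum.inr (Sum.inl i)))
    have e : f (Sum.inl i) + f (Sum.inr (Sum.inl i)) = a i := add_sub_cancel (c i) (a i)
    rwa [e] at this
  -- `x` is the sum of its parts in the blocks and of its part outside them.
  · have e : (x, (∑ i, c i + w).2) = ∑ i, c i + w := by
      refine Prod.ext ?_ rfl
      rw [Prod.fst_add, Prod.fst_sum]
      change x = ∑ i, (a i).1 * x + (x - x * A.1)
      rw [← Finset.sum_mul, hA, Prod.fst_sum, mul_comm x]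
      abel
    rw [e]
    exact Submodule.add_mem _ (Submodule.sum_mem _ fun i _ => hf (Sum.inl i))
      (hf (Sum.inr (Sum.inr ())))

lemma IsPartialIso.extend_symm (hα : 0 < α) (hH : H.LocallyStandard)
    (hD : ∀ y : H', ∃ x : H, H'.μ y = α * H.μ x)
    {R : Submodule (ZMod 2) (H × H')} (h : IsPartialIso α R) (y : H') :
    ∃ R', IsPartialIso α R' ∧ R ≤ R' ∧ ∃ x, (x, y) ∈ R' := by
  obtain ⟨R', h1, h2, x, h3⟩ := (h.swap hα).extend (inv_pos.2 hα) hH (fun y => by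
    obtain ⟨x, hx⟩ := hD y
    exact ⟨x, by rw [hx, inv_mul_cancel_left₀ hα.ne']⟩) y
  have h4 := h1.swap (inv_pos.2 hα)
  rw [inv_inv] at h4
  refine ⟨_, h4, fun p hp => ⟨p.swap, h2 ⟨p, hp, rfl⟩, rfl⟩, x, ⟨(y, x), h3, rfl⟩⟩

/-- Enumerations of both algebras are fed alternately into the two extension lemmas. The union of
the resulting chain of graphs is the graph of the isomorphism. -/
theorem scalarEquiv_of_range_μ [Countable H] [Countable H'] (hα : 0 < α) (hH : H.LocallyStandard)
    (hH' : H'.LocallyStandard) (hD : Set.range H'.μ = (fun x => α * x) '' Set.range H.μ) :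
    ScalarEquiv H H' := by
  have hD1 : ∀ x : H, ∃ y : H', H'.μ y = α * H.μ x := fun x =>
    (Set.ext_iff.1 hD _).2 ⟨_, ⟨x, rfl⟩, rfl⟩
  have hD2 : ∀ y : H', ∃ x : H, H'.μ y = α * H.μ x := fun y => by
    obtain ⟨_, ⟨x, rfl⟩, hx⟩ := (Set.ext_iff.1 hD _).1 ⟨y, rfl⟩
    exact ⟨x, hx.symm⟩
  obtain ⟨xs, hxs⟩ := exists_surjective_nat H
  obtain ⟨ys, hys⟩ := exists_surjective_nat H'
  have hstep : ∀ (n : ℕ) (R : {R : Submodule (ZMod 2) (H × H') // IsPartialIso α R}),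
      ∃ R' : {R : Submodule (ZMod 2) (H × H') // IsPartialIso α R}, R.1 ≤ R'.1 ∧
        (∃ y, (xs n, y) ∈ R'.1) ∧ ∃ x, (x, ys n) ∈ R'.1 := by
    rintro n ⟨R, hR⟩
    obtain ⟨R₁, h1, h2, y, hy⟩ := hR.extend hα hH' hD1 (xs n)
    obtain ⟨R₂, h3, h4, x, hx⟩ := h1.extend_symm hα hH hD2 (ys n)
    exact ⟨⟨R₂, h3⟩, h2.trans h4, ⟨y, h4 hy⟩, x, hx⟩
  choose F hF1 hF2 hF3 using hstep
  let R : ℕ → {R : Submodule (ZMod 2) (H × H') // IsPartialIso α R} := fun n =>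
    Nat.rec ⟨⊥, isPartialIso_bot⟩ F n
  have hmono : Monotone fun n => (R n).1 := monotone_nat_of_le_succ fun n => hF1 n (R n)
  have hpair : ∀ {p q : H × H'}, (∃ n, p ∈ (R n).1) → (∃ n, q ∈ (R n).1) →
      ∃ n, p ∈ (R n).1 ∧ q ∈ (R n).1 := by
    rintro p q ⟨n, hn⟩ ⟨m, hm⟩
    exact ⟨max n m, hmono (le_max_left n m) hn, hmono (le_max_right n m) hm⟩
  have hex : ∀ x, ∃ y, ∃ n, (x, y) ∈ (R n).1 := fun x => by
    obtain ⟨n, rfl⟩ := hxs x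
    obtain ⟨y, hy⟩ := hF2 n (R n)
    exact ⟨y, n + 1, hy⟩
  have hex' : ∀ y, ∃ x, ∃ n, (x, y) ∈ (R n).1 := fun y => by
    obtain ⟨n, rfl⟩ := hys y
    obtain ⟨x, hx⟩ := hF3 n (R n)
    exact ⟨x, n + 1, hx⟩
  -- The difference (0, y - y') lies in the graph, so y - y' has measure α · 0 and vanishes.
  -- Single-valuedness and injectivity thus come from the measure alone.
  have huniq : ∀ {x y y'}, (∃ n, (x, y) ∈ (R n).1) → (∃ n, (x, y') ∈ (R n).1) → y = y' := by
    intro x y y' h h'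
    obtain ⟨n, h1, h2⟩ := hpair h h'
    have h3 := (R n).2.μ_eq (Submodule.sub_mem _ h1 h2)
    simp only [Prod.mk_sub_mk, sub_self, μ_zero, mul_zero] at h3
    exact sub_eq_zero.1 ((H'.eq_zero_iff' _).1 h3)
  have huniq' : ∀ {x x' y}, (∃ n, (x, y) ∈ (R n).1) → (∃ n, (x', y) ∈ (R n).1) → x = x' := by
    intro x x' y h h'
    obtain ⟨n, h1, h2⟩ := hpair h h'
    have h3 := (R n).2.μ_eq (Submodule.sub_mem _ h1 h2)
    simp only [Prod.mk_sub_mk, sub_self, μ_zero] at h3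
    exact sub_eq_zero.1 ((H.eq_zero_iff' _).1 ((mul_eq_zero.1 h3.symm).resolve_left hα.ne'))
  choose φ hφ using hex
  choose ψ hψ using hex'
  refine ⟨α, hα, ⟨⟨φ, ψ, fun x => huniq' (hψ _) (hφ x), fun y => huniq (hφ _) (hψ y)⟩,
    fun x y => ?_, fun x y => ?_⟩, fun x => ?_⟩
  · obtain ⟨n, h1, h2⟩ := hpair (hφ x) (hφ y)
    exact huniq (hφ _) ⟨n, (R n).2.mul_mem h1 h2⟩
  · obtain ⟨n, h1, h2⟩ := hpair (hφ x) (hφ y)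
    exact huniq (hφ _) ⟨n, Submodule.add_mem _ h1 h2⟩
  · obtain ⟨n, hn⟩ := hφ x
    exact (R n).2.μ_eq hn

lemma ScalarEquiv.range_μ (h : ScalarEquiv H H') :
    ∃ α : ℝ, 0 < α ∧ Set.range H'.μ = (fun x => α * x) '' Set.range H.μ := by
  obtain ⟨α, hα, φ, hφ⟩ := h
  refine ⟨α, hα, ?_⟩
  rw [← Set.range_comp, ← φ.surjective.range_comp]
  exact congrArg Set.range (funext hφ)

theorem scalarEquiv_iff [Countable H] [Countable H'] (hH : H.LocallyStandard)
    (hH' : H'.LocallyStandard) : ScalarEquiv H H' ↔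
      ∃ α : ℝ, 0 < α ∧ Set.range H'.μ = (fun x => α * x) '' Set.range H.μ :=
  ⟨ScalarEquiv.range_μ, fun ⟨_, hα, h⟩ => scalarEquiv_of_range_μ hα hH hH' h⟩

end BackAndForth

end MeasureAlgebra

namespace MeasureAlgebra

open SteinitzNumber

/-! ### Countability and standard families of the building blocks -/

section Constructions

instance (n : ℕ) : Countable (St n) := inferInstanceAs (Countable (Fin n → ZMod 2))

lemma St_hasStdFamilies (n : ℕ) : HasStdFamilies (St n) {(n, 1 / (n : ℝ))} where
  occurs := by
    rintro _ rfl
    exact ⟨_, stBasis_isStdFamily n⟩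
  covers F _ := ⟨_, rfl, _, stBasis_isStdFamily n, fun x _ =>
    mem_span_range_iff_exists_finset.2 (exists_sum_stBasis x)⟩

instance : Countable Hinf := by
  refine Function.Injective.countable (f := fun x : Hinf => x.2.toFinset) fun x y h => ?_
  have h' : Function.support x.1 = Function.support y.1 := by
    rw [← Set.Finite.coe_toFinset x.2, ← Set.Finite.coe_toFinset y.2]
    exact congrArg _ h
  have key : ∀ a b : ZMod 2, (a ≠ 0 ↔ b ≠ 0) → a = b := by decide
  exact Subtype.ext (funext fun i => key _ _ (Set.ext_iff.1 h' i))

/-- The one-element sets, as elements of `Hinf`. -/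
def hinfBasis (i : ℕ) : Hinf :=
  ⟨Pi.single i 1, (Set.finite_singleton i).subset Pi.support_single_subset⟩

/-- The inclusion of `Hinf` into the sequences. -/
def hinfVal : Hinf →+ (ℕ → ZMod 2) where
  toFun x := x.1
  map_zero' := rfl
  map_add' _ _ := rfl

/-- One coordinate of the expansion of a 0–1 sequence into indicator functions: only the indicator
with index `j` contributes. It serves both `Hinf` and `Per`. -/
lemma sum_filter_ne_zero {ι : Type} (T : Finset ι) (x : ι → ZMod 2) (j : ι) (f : ι → ZMod 2)
    (hj : f j = 1) (hf : ∀ i ≠ j, f i = 0) (hT : x j ≠ 0 → j ∈ T) [DecidablePred fun i => x i ≠ 0] :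
    ∑ i ∈ T.filter (fun i => x i ≠ 0), f i = x j := by
  rw [Finset.sum_filter]
  by_cases h : x j = 0
  · rw [h]
    refine Finset.sum_eq_zero fun i _ => ?_
    rcases eq_or_ne i j with rfl | hi
    · simp [h]
    · simp [hf i hi]
  · rw [Finset.sum_eq_single_of_mem j (hT h) fun i _ hi => by simp [hf i hi]]
    have : ∀ z : ZMod 2, z ≠ 0 → z = 1 := by decide
    rw [if_pos h, hj, this _ h]

lemma hinfBasis_isStdFamily (n : ℕ) : IsStdFamily (fun i : Fin n => hinfBasis i) 1 := by
  refine ⟨fun i j hij => Subtype.ext (funext fun l => ?_), fun i => ?_⟩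
  · change (Pi.single i.1 1 : ℕ → ZMod 2) l * (Pi.single j.1 1 : ℕ → ZMod 2) l = 0
    have hij' : i.1 ≠ j.1 := fun h => hij (Fin.ext h)
    rcases eq_or_ne l i with rfl | h
    · simp [hij']
    · simp [h]
  · change ((Function.support (Pi.single i.1 1 : ℕ → ZMod 2)).ncard : ℝ) = 1
    rw [Pi.support_single_of_ne one_ne_zero, Set.ncard_singleton, Nat.cast_one]

lemma Hinf_hasStdFamilies : HasStdFamilies Hinf {p | p.2 = 1} where
  occurs := by
    rintro ⟨n, _⟩ rfl
    exact ⟨_, hinfBasis_isStdFamily n⟩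
  covers F hF := by
    classical
    have hfin : (⋃ x ∈ F, Function.support x.1).Finite := hF.biUnion fun x _ => x.2
    obtain ⟨N, hN⟩ := hfin.bddAbove
    refine ⟨(N + 1, 1), rfl, _, hinfBasis_isStdFamily (N + 1), fun x hx => ?_⟩
    refine mem_span_range_iff_exists_finset.2
      ⟨Finset.univ.filter fun i : Fin (N + 1) => x.1 i.1 ≠ 0, Subtype.ext (funext fun j => ?_)⟩
    change hinfVal _ j = x.1 j
    rw [map_sum, Finset.sum_apply]
    by_cases hj : j < N + 1
    · refine sum_filter_ne_zero Finset.univ (fun i : Fin (N + 1) => x.1 i.1) ⟨j, hj⟩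
        (fun i => hinfVal (hinfBasis i) j) (Pi.single_eq_same j 1)
        (fun i hi => Pi.single_eq_of_ne (fun h => hi (Fin.ext h.symm)) 1)
        fun _ => Finset.mem_univ _
    · have h0 : x.1 j = 0 := by
        by_contra h
        exact hj (Nat.lt_succ_of_le (hN (Set.mem_biUnion hx h)))
      rw [h0]
      exact Finset.sum_eq_zero fun i _ => Pi.single_eq_of_ne (fun h => hj (lt_of_eq_of_lt h i.2)) 1

/-- A period together with the terms of one period determines the sequence. -/
instance (u : SteinitzNumber) : Countable (Per u) := by
  refine Function.Injective.countable (β := Σ k : ℕ, (Fin k → ZMod 2))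
    (f := fun x : Per u => ⟨x.2.choose, fun i => x.1 i⟩) fun x y h => ?_
  have hx := x.2.choose_spec
  have hy := y.2.choose_spec
  dsimp only at h
  generalize x.2.choose = k at h hx
  generalize y.2.choose = l at h hy
  obtain rfl : k = l := congrArg Sigma.fst h
  have h' := eq_of_heq (Sigma.mk.inj h).2
  refine Subtype.ext (funext fun i => ?_)
  rw [← hx.2.map_mod_nat, ← hy.2.map_mod_nat]
  exact congrFun h' ⟨i % k, Nat.mod_lt _ hx.1.1⟩

/-- The residue class of `c` modulo `k`, as an element of `Per u`. -/
def residueClass {u : SteinitzNumber} {k : ℕ} (hk : k ∈ u.Ω) (c : Fin k) : Per u :=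
  ⟨fun i => if i % k = c then 1 else 0, k, hk, fun i => by simp⟩

/-- The inclusion of `Per u` into the sequences. -/
def perVal (u : SteinitzNumber) : Per u →+ (ℕ → ZMod 2) where
  toFun x := x.1
  map_zero' := rfl
  map_add' _ _ := rfl

lemma perVal_residueClass {u : SteinitzNumber} {k : ℕ} (hk : k ∈ u.Ω) (c : Fin k) (i : ℕ) :
    perVal u (residueClass hk c) i = if i % k = c then 1 else 0 := rfl

lemma residueClass_isStdFamily {u : SteinitzNumber} {k : ℕ} (hk : k ∈ u.Ω) :
    IsStdFamily (residueClass hk) (1 / k) := by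
  refine ⟨fun i j hij => Subtype.ext (funext fun l => ?_), fun c => ?_⟩
  · change (if l % k = i then (1 : ZMod 2) else 0) * (if l % k = j then (1 : ZMod 2) else 0) = 0
    have hij' : i.1 ≠ j.1 := fun h => hij (Fin.ext h)
    split_ifs <;> first | omega | simp
  · rw [Per_μ _ hk.1 fun i => by simp [residueClass]]
    unfold mean
    congr 1
    rw [Finset.sum_eq_single_of_mem c.1 (Finset.mem_range.2 c.2)]
    · simp [residueClass, Nat.mod_eq_of_lt c.2, ZMod.val_one]
    · intro i hi hic
      simp [residueClass, Nat.mod_eq_of_lt (Finset.mem_range.1 hi), hic]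

lemma one_mem_Ω (u : SteinitzNumber) : 1 ∈ u.Ω := ⟨one_pos, fun p => by simp⟩

/-- Finitely many sequences have a common period in Ω(u), the least common multiple of theirs, and
the residue classes modulo that period span them. -/
lemma Per_hasStdFamilies (u : SteinitzNumber) :
    HasStdFamilies (Per u) {p | p.1 ∈ u.Ω ∧ p.2 = 1 / p.1} where
  occurs := by
    rintro ⟨n, ε⟩ ⟨hn, hε⟩
    simp only at hn hε
    subst hε
    exact ⟨_, residueClass_isStdFamily hn⟩
  covers F hF := by
    classical
    obtain ⟨k, hk, hper⟩ : ∃ k ∈ u.Ω, ∀ x ∈ F, Function.Periodic x.1 k := by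
      induction F, hF using Set.Finite.induction_on with
      | empty => exact ⟨1, one_mem_Ω u, by simp⟩
      | @insert x F _ _ ih =>
        obtain ⟨k, hk, h⟩ := ih
        obtain ⟨l, hl, hx⟩ := x.2
        refine ⟨k.lcm l, lcm_mem hk hl, ?_⟩
        rintro y (rfl | hy)
        · exact periodic_of_dvd hx (Nat.dvd_lcm_right k l)
        · exact periodic_of_dvd (h y hy) (Nat.dvd_lcm_left k l)
    refine ⟨(k, 1 / k), ⟨hk, rfl⟩, _, residueClass_isStdFamily hk, fun x hx => ?_⟩
    refine mem_span_range_iff_exists_finset.2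
      ⟨Finset.univ.filter fun i : Fin k => x.1 i.1 ≠ 0, Subtype.ext (funext fun j => ?_)⟩
    change perVal u _ j = x.1 j
    rw [map_sum, Finset.sum_apply, ← (hper x hx).map_mod_nat j]
    refine sum_filter_ne_zero Finset.univ (fun i : Fin k => x.1 i.1) ⟨j % k, Nat.mod_lt _ hk.1⟩
        (fun i => perVal u (residueClass hk i) j) ?_ ?_ fun _ => Finset.mem_univ _
    · rw [perVal_residueClass, if_pos rfl]
    · intro i hi
      rw [perVal_residueClass, if_neg fun h => hi (Fin.ext h.symm)]

variable {A : MeasureAlgebra.{u}} {B : MeasureAlgebra.{v}}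

instance [Countable A] [Countable B] : Countable (tensor A B) := by
  refine Function.Surjective.countable (α := List (A × B)) (β := A ⊗[ZMod 2] B)
    (f := fun l => (l.map fun p => p.1 ⊗ₜ[ZMod 2] p.2).sum) fun t => ?_
  induction t using TensorProduct.induction_on with
  | zero => exact ⟨[], rfl⟩
  | tmul x y => exact ⟨[(x, y)], by simp⟩
  | add x y hx hy =>
    obtain ⟨l, rfl⟩ := hx
    obtain ⟨l', rfl⟩ := hy
    exact ⟨l ++ l', by simp⟩

lemma tensor_isStdFamily {ι κ : Type} {e : ι → A} {f : κ → B} {ε δ : ℝ} (he : IsStdFamily e ε)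
    (hf : IsStdFamily f δ) : IsStdFamily (H := tensor A B)
      (fun p : ι × κ => e p.1 ⊗ₜ[ZMod 2] f p.2) (ε * δ) := by
  refine ⟨fun p q hpq => ?_, fun p => ?_⟩
  · refine (Algebra.TensorProduct.tmul_mul_tmul _ _ _ _).trans ?_
    by_cases h : p.1 = q.1
    · have h' : p.2 ≠ q.2 := fun h' => hpq (Prod.ext h h')
      rw [hf.orth _ _ h', TensorProduct.tmul_zero]
      rfl
    · rw [he.orth _ _ h, TensorProduct.zero_tmul]
      rfl
  · refine (tensorμ_tmul _ _).trans ?_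
    rw [he.meas, hf.meas]

/-- Finitely many tensors involve only finitely many left and right factors; this reduces covering
in A ⊗ B to covering in A and in B. -/
lemma exists_finite_mem_map₂ (F : Set (A ⊗[ZMod 2] B)) (hF : F.Finite) :
    ∃ (FA : Set A) (FB : Set B), FA.Finite ∧ FB.Finite ∧
      ∀ (P : Submodule (ZMod 2) A) (Q : Submodule (ZMod 2) B), FA ⊆ P → FB ⊆ Q →
        F ⊆ Submodule.map₂ (TensorProduct.mk (ZMod 2) A B) P Q := by
  induction F, hF using Set.Finite.induction_on with
  | empty => exact ⟨∅, ∅, Set.finite_empty, Set.finite_empty, fun P Q _ _ => Set.empty_subset _⟩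
  | @insert t F _ _ ih =>
    obtain ⟨FA, FB, h1, h2, h3⟩ := ih
    obtain ⟨ι, _, a, b, -, rfl⟩ := exists_rep t
    refine ⟨FA ∪ Set.range a, FB ∪ Set.range b, h1.union (Set.finite_range a),
      h2.union (Set.finite_range b), fun P Q hP hQ => Set.insert_subset ?_ (h3 P Q
        (Set.subset_union_left.trans hP) (Set.subset_union_left.trans hQ))⟩
    exact Submodule.sum_mem _ fun i _ => Submodule.apply_mem_map₂ _ (hP (Or.inr ⟨i, rfl⟩))
      (hQ (Or.inr ⟨i, rfl⟩))

lemma HasStdFamilies.tensor {S S' : Set (ℕ × ℝ)} (hA : HasStdFamilies A S)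
    (hB : HasStdFamilies B S') : HasStdFamilies (tensor A B)
      {p | ∃ a ∈ S, ∃ b ∈ S', p = (a.1 * b.1, a.2 * b.2)} where
  occurs := by
    rintro _ ⟨a, ha, b, hb, rfl⟩
    obtain ⟨e, he⟩ := hA.occurs a ha
    obtain ⟨f, hf⟩ := hB.occurs b hb
    obtain ⟨g, hg, -⟩ := exists_stdFamily_fin (tensor_isStdFamily he hf) (n := a.1 * b.1) (by simp)
    exact ⟨g, hg⟩
  covers F hF := by
    obtain ⟨FA, FB, h1, h2, h3⟩ := exists_finite_mem_map₂ (A := A) (B := B) F hF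
    obtain ⟨a, ha, e, he, heF⟩ := hA.covers FA h1
    obtain ⟨b, hb, f, hf, hfF⟩ := hB.covers FB h2
    obtain ⟨g, hg, hg'⟩ := exists_stdFamily_fin (tensor_isStdFamily he hf) (n := a.1 * b.1)
      (by simp)
    refine ⟨_, ⟨a, ha, b, hb, rfl⟩, g, hg, ?_⟩
    have h4 := h3 _ _ heF hfF
    rw [Submodule.map₂_span_span, Set.image2_range] at h4
    refine h4.trans (SetLike.coe_subset_coe.2 ?_)
    rw [hg']
    exact le_rfl

variable {G : ℕ → MeasureAlgebra.{u}} {f : ∀ i, G i →ₙₐ[ZMod 2] G (i + 1)} {c : ℕ → ℝ}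
  {hc0 : ∀ i, 0 ≤ c i} {hc1 : ∀ i (x : G i), c i * (G i).μ x = 0 → x = 0}
  {hc : ∀ i (x : G i), c (i + 1) * (G (i + 1)).μ (f i x) = c i * (G i).μ x}

instance [∀ i, Countable (G i)] : Countable (union G f c hc0 hc1 hc) := by
  refine Function.Surjective.countable (α := Σ i, G i)
    (f := fun p => (Quotient.mk _ p : DirectLimit (fun i => (G i : Type u)) (transition G f))) ?_
  exact Quotient.mk_surjective

variable (hc0 hc1 hc) in
/-- The inclusion of `G i` into the union. -/
def unionIncl (i : ℕ) : G i →ₙ+* union G f c hc0 hc1 hc where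
  toFun x := (⟦⟨i, x⟩⟧ : DirectLimit (fun i => (G i : Type u)) (transition G f))
  map_zero' := (DirectLimit.zero_def (f := transition G f) i).symm
  map_add' x y := (DirectLimit.add_def (f := transition G f) i x y).symm
  map_mul' x y := (DirectLimit.mul_def (f := transition G f) i x y).symm

lemma unionIncl_transition {i j : ℕ} (h : i ≤ j) (x : G i) :
    unionIncl hc0 hc1 hc j (transition G f i j h x) = unionIncl hc0 hc1 hc i x :=
  (DirectLimit.eq_of_le (f := transition G f) (⟨i, x⟩ : Σ i, G i) j h).symm

lemma union_μ (i : ℕ) (x : G i) :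
    (union G f c hc0 hc1 hc).μ (unionIncl hc0 hc1 hc i x) = c i * (G i).μ x :=
  rfl

lemma unionIncl_surjective (z : union G f c hc0 hc1 hc) : ∃ i x, unionIncl hc0 hc1 hc i x = z := by
  obtain ⟨⟨i, x⟩, rfl⟩ := Quotient.mk_surjective z
  exact ⟨i, x, rfl⟩

/-- A finite subset of the union comes from a single stage, and the inclusion of stage i only
multiplies measures by c i. -/
lemma HasStdFamilies.union {S : ℕ → Set (ℕ × ℝ)} (hS : ∀ i, HasStdFamilies (G i) (S i)) :
    HasStdFamilies (union G f c hc0 hc1 hc) {p | ∃ i, ∃ q ∈ S i, p = (q.1, c i * q.2)} := by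
  have hfam : ∀ i {n : ℕ} {e : Fin n → G i} {ε : ℝ}, IsStdFamily e ε →
      IsStdFamily (fun l => unionIncl hc0 hc1 hc i (e l)) (c i * ε) := fun i n e ε he =>
    ⟨fun l m hlm => by rw [← map_mul, he.orth l m hlm, map_zero], fun l => by
      rw [union_μ, he.meas]⟩
  constructor
  · rintro _ ⟨i, q, hq, rfl⟩
    obtain ⟨e, he⟩ := (hS i).occurs q hq
    exact ⟨_, hfam i he⟩
  · intro F hF
    obtain ⟨i, F', hF', hFF⟩ : ∃ i, ∃ F' : Set (G i), F'.Finite ∧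
        F ⊆ unionIncl hc0 hc1 hc i '' F' := by
      induction F, hF using Set.Finite.induction_on with
      | empty => exact ⟨0, ∅, Set.finite_empty, Set.empty_subset _⟩
      | @insert z F _ _ ih =>
        obtain ⟨i, F', h1, h2⟩ := ih
        obtain ⟨j, x, rfl⟩ := unionIncl_surjective z
        refine ⟨max i j, insert (transition G f j _ (le_max_right i j) x)
          (transition G f i _ (le_max_left i j) '' F'), (h1.image _).insert _, ?_⟩
        rintro w (rfl | hw)
        · exact ⟨_, Set.mem_insert _ _, unionIncl_transition _ _⟩
        · obtain ⟨y, hy, rfl⟩ := h2 hw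
          exact ⟨_, Set.mem_insert_of_mem _ ⟨y, hy, rfl⟩, unionIncl_transition _ _⟩
    obtain ⟨q, hq, e, he, heF⟩ := (hS i).covers F' hF'
    refine ⟨_, ⟨i, q, hq, rfl⟩, _, hfam i he, fun z hz => ?_⟩
    obtain ⟨x, hx, rfl⟩ := hFF hz
    obtain ⟨T, rfl⟩ := mem_span_range_iff_exists_finset.1 (heF hx)
    exact mem_span_range_iff_exists_finset.2 ⟨T, (map_sum _ _ _).symm⟩

end Constructions

end MeasureAlgebra

/-! ### Divisors of Steinitz numbers and the fractions they define -/

namespace SteinitzNumber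

variable {s s' : SteinitzNumber}

lemma mul_mem_Ω {b c : ℕ} (hb : b ∈ s.Ω) (hc : c ∈ (s.quot b).Ω) : b * c ∈ s.Ω := by
  refine ⟨Nat.mul_pos hb.1 hc.1, fun p => ?_⟩
  rw [Nat.factorization_mul hb.1.ne' hc.1.ne', Finsupp.add_apply, Nat.cast_add]
  exact (add_le_add_right (hc.2 p) _).trans_eq (add_tsub_cancel_of_le (hb.2 p))

lemma pow_mem_Ω {p : Nat.Primes} {k : ℕ} : p.1 ^ k ∈ s.Ω ↔ (k : ℕ∞) ≤ s p := by
  constructor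
  · intro h
    simpa [p.2.factorization_pow] using h.2 p
  · intro h
    refine ⟨pow_pos p.2.pos k, fun q => ?_⟩
    rw [p.2.factorization_pow]
    rcases eq_or_ne q p with rfl | hq
    · simpa using h
    · have h' : q.1 ≠ p.1 := fun h => hq (Subtype.ext h)
      simp [Finsupp.single_eq_of_ne h']

/-- A divisor of the least common multiple of a directed family divides a member of it. -/
lemma exists_dvd_of_mem_Ω {ι : Type*} [Nonempty ι] {B : ι → ℕ} (hpos : ∀ i, 0 < B i)
    (hdir : ∀ i j, ∃ k, B i ∣ B k ∧ B j ∣ B k)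
    (hs : ∀ p, s p ≤ ⨆ i, ((B i).factorization p : ℕ∞)) {b : ℕ} (hb : b ∈ s.Ω) :
    ∃ i, b ∣ B i := by
  classical
  -- Only the finitely many primes dividing `b` matter, and directedness allows them to be treated
  -- one at a time.
  have key : ∀ T : Finset ℕ, ∃ i, ∀ p ∈ T, b.factorization p ≤ (B i).factorization p := by
    intro T
    induction T using Finset.induction_on with
    | empty => exact ⟨Classical.arbitrary ι, by simp⟩
    | insert p T _ ih =>
      obtain ⟨i, hi⟩ := ih
      obtain ⟨j, hj⟩ : ∃ j, b.factorization p ≤ (B j).factorization p := by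
        by_cases hp : p.Prime
        · by_contra! h
          have h1 := (hb.2 ⟨p, hp⟩).trans (hs ⟨p, hp⟩)
          -- If all exponents are strictly smaller than that of `b`, their supremum misses it by at
          -- least one. The subtraction is not truncated, as some index exists.
          have h2 : ⨆ i, ((B i).factorization p : ℕ∞) ≤ ((b.factorization p - 1 : ℕ) : ℕ∞) :=
            iSup_le fun i => by
              have := h i
              exact_mod_cast Nat.le_sub_one_of_lt this
          have h3 : b.factorization p ≤ b.factorization p - 1 := by exact_mod_cast h1.trans h2
          have := h (Classical.arbitrary ι)
          omega
        · exact ⟨Classical.arbitrary ι, by simp [Nat.factorization_eq_zero_of_not_prime _ hp]⟩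
      obtain ⟨k, h1, h2⟩ := hdir i j
      refine ⟨k, fun q hq => ?_⟩
      rcases Finset.mem_insert.1 hq with rfl | hq
      · exact hj.trans ((Nat.factorization_le_iff_dvd (hpos j).ne' (hpos k).ne').2 h2 q)
      · exact (hi q hq).trans ((Nat.factorization_le_iff_dvd (hpos i).ne' (hpos k).ne').2 h1 q)
  obtain ⟨i, hi⟩ := key b.primeFactors
  refine ⟨i, (Nat.factorization_le_iff_dvd hb.1.ne' (hpos i).ne').1 fun p => ?_⟩
  by_cases hp : p ∈ b.primeFactors
  · exact hi p hp
  · have : b.factorization p = 0 := Finsupp.notMem_support_iff.1 (by simpa using hp)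
    rw [this]
    exact Nat.zero_le _

lemma DivisorChain.dvd_of_le (ch : DivisorChain s) {i j : ℕ} (h : i ≤ j) : ch.b i ∣ ch.b j := by
  induction j, h using Nat.le_induction with
  | base => exact dvd_rfl
  | succ j _ ih => exact ih.trans (ch.dvd j)

lemma DivisorChain.exists_dvd (ch : DivisorChain s) {b : ℕ} (hb : b ∈ s.Ω) : ∃ i, b ∣ ch.b i :=
  exists_dvd_of_mem_Ω (fun i => (ch.mem i).1)
    (fun i j => ⟨max i j, ch.dvd_of_le (le_max_left i j), ch.dvd_of_le (le_max_right i j)⟩)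
    (fun p => (ch.lcm p).ge) hb

lemma le_iff_forall_natCast_le {a b : ℕ∞} : a ≤ b ↔ ∀ k : ℕ, (k : ℕ∞) ≤ a → (k : ℕ∞) ≤ b := by
  refine ⟨fun h k hk => hk.trans h, fun h => ?_⟩
  induction a using ENat.recTopCoe with
  | top => exact (ENat.eq_top_iff_forall_ge.2 fun k => h k le_top).ge
  | coe k => exact h k le_rfl

/-- Running least common multiples of an enumeration of Ω(s); prime powers in Ω(s) show that every
exponent is reached. -/
lemma exists_divisorChain (s : SteinitzNumber) : Nonempty (DivisorChain s) := by
  have : Nonempty s.Ω := ⟨⟨1, MeasureAlgebra.one_mem_Ω s⟩⟩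
  obtain ⟨f, hf⟩ := exists_surjective_nat s.Ω
  let b : ℕ → s.Ω := fun n => Nat.rec (f 0) (fun i x => ⟨x.1.lcm (f i).1, lcm_mem x.2 (f i).2⟩) n
  refine ⟨⟨fun i => (b i).1, fun i => (b i).2, fun i => Nat.dvd_lcm_left _ _, fun p => ?_⟩⟩
  refine le_antisymm (iSup_le fun i => (b i).2.2 p) (le_iff_forall_natCast_le.2 fun k hk => ?_)
  obtain ⟨i, hi⟩ := hf ⟨p.1 ^ k, pow_mem_Ω.2 hk⟩
  refine le_iSup_of_le (i + 1) ?_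
  have h1 : p.1 ^ k ∣ (b (i + 1)).1 := by
    have h2 : (f i).1 ∣ (b (i + 1)).1 := Nat.dvd_lcm_right _ _
    rwa [hi] at h2
  have h3 := (Nat.factorization_le_iff_dvd (pow_pos p.2.pos k).ne' (b (i + 1)).2.1.ne').2 h1 p
  rw [p.2.factorization_pow, Finsupp.single_eq_same] at h3
  exact_mod_cast h3

/-- If Ω(s) were bounded, its largest member would be divisible by all others, because Ω(s) is
closed under least common multiples, and s would equal that integer. -/
lemma IsInfinite.exists_lt (hs : s.IsInfinite) (N : ℕ) : ∃ b ∈ s.Ω, N < b := by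
  by_contra! h
  have hfin : s.Ω.Finite := (Set.finite_Iic N).subset h
  obtain ⟨b, hb, hmax⟩ := hfin.exists_maximalFor id _ ⟨1, MeasureAlgebra.one_mem_Ω s⟩
  have hdvd : ∀ c ∈ s.Ω, c ∣ b := fun c hc => by
    have h1 := hmax (lcm_mem hb hc) (Nat.le_of_dvd (Nat.lcm_pos hb.1 hc.1) (Nat.dvd_lcm_left b c))
    have h2 : b.lcm c = b := le_antisymm h1
      (Nat.le_of_dvd (Nat.lcm_pos hb.1 hc.1) (Nat.dvd_lcm_left b c))
    rw [← h2]
    exact Nat.dvd_lcm_right b c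
  refine hs b hb.1 (funext fun p =>
    le_antisymm (le_iff_forall_natCast_le.2 fun k hk => ?_) (hb.2 p))
  have h3 := (Nat.factorization_le_iff_dvd (pow_pos p.2.pos k).ne' hb.1.ne').2
    (hdvd _ (pow_mem_Ω.2 hk)) p
  rw [p.2.factorization_pow, Finsupp.single_eq_same] at h3
  exact Nat.cast_le.2 h3

/-- The nonnegative fractions whose denominator divides `s`. -/
def fractions (s : SteinitzNumber) : Set ℝ := {x | ∃ a : ℕ, ∃ b ∈ s.Ω, x = a / b}

lemma nat_mul_mem_fractions {x : ℝ} (hx : x ∈ s.fractions) (n : ℕ) : n * x ∈ s.fractions := by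
  obtain ⟨a, b, hb, rfl⟩ := hx
  exact ⟨n * a, b, hb, by push_cast; ring⟩

lemma ofNat_mul_apply (n : ℕ) (s : SteinitzNumber) (p : Nat.Primes) :
    (ofNat n * s) p = n.factorization p + s p := rfl

/-- Cancelling u against vb in ua/(vb) leaves a denominator whose exponents are those of vb minus
those of u, cut off at 0. These are at most those of s' because vs divides us'. -/
lemma scale_fractions {u v : ℕ} (hu : 0 < u) (hv : 0 < v)
    (h : ∀ p, (ofNat v * s) p ≤ (ofNat u * s') p) {x : ℝ} (hx : x ∈ s.fractions) :
    (u : ℝ) / v * x ∈ s'.fractions := by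
  obtain ⟨a, b, hb, rfl⟩ := hx
  have hvb : 0 < v * b := Nat.mul_pos hv hb.1
  -- With L = lcm(vb, u), the reduced fraction is aM/N for M = L/(vb) and N = L/u.
  obtain ⟨N, hN⟩ := Nat.dvd_lcm_right (v * b) u
  obtain ⟨M, hM⟩ := Nat.dvd_lcm_left (v * b) u
  have hpos : 0 < (v * b).lcm u := Nat.lcm_pos hvb hu
  have hN0 : 0 < N := Nat.pos_of_ne_zero fun h => by rw [h] at hN; omega
  have hNΩ : N ∈ s'.Ω := by
    refine ⟨hN0, fun p => ?_⟩
    have h1 : ((v * b).lcm u).factorization p = u.factorization p + N.factorization p := by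
      rw [hN, Nat.factorization_mul hu.ne' hN0.ne']; rfl
    rw [Nat.factorization_lcm hvb.ne' hu.ne'] at h1
    simp only [Finsupp.sup_apply] at h1
    have h2 : ((v * b).factorization p : ℕ∞) ≤ u.factorization p + s' p := by
      rw [Nat.factorization_mul hv.ne' hb.1.ne', Finsupp.add_apply, Nat.cast_add]
      exact (add_le_add_right (hb.2 p) _).trans (h p)
    rcases le_total ((v * b).factorization p) (u.factorization p) with h' | h'
    · rw [sup_eq_right.2 h'] at h1
      have : N.factorization p = 0 := by omega
      simp [this]
    · rw [sup_eq_left.2 h'] at h1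
      rw [h1, Nat.cast_add] at h2
      exact (ENat.add_le_add_iff_left (ENat.natCast_ne_top _)).1 h2
  refine ⟨a * M, N, hNΩ, ?_⟩
  have e : (v : ℝ) * b * M = u * N := by exact_mod_cast hM.symm.trans hN
  have hv' : (v : ℝ) ≠ 0 := by positivity
  have hb' : (b : ℝ) ≠ 0 := by exact_mod_cast hb.1.ne'
  have hN' : (N : ℝ) ≠ 0 := by positivity
  push_cast
  field_simp
  linear_combination (-a : ℝ) * e

/-- Tested on 1/pᵏ with pᵏ ∈ Ω(s): from u/(v pᵏ) = c/d with d ∈ Ω(s') follows ud = cvpᵏ, and the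
exponents of p are compared. Testing all finite k also covers an infinite exponent. -/
lemma le_of_scale_fractions {u v : ℕ} (hu : 0 < u) (hv : 0 < v)
    (h : ∀ x ∈ s.fractions, (u : ℝ) / v * x ∈ s'.fractions) (p : Nat.Primes) :
    (ofNat v * s) p ≤ (ofNat u * s') p := by
  have key : ∀ k : ℕ, (k : ℕ∞) ≤ s p → ((v.factorization p + k : ℕ) : ℕ∞) ≤ (ofNat u * s') p := by
    intro k hk
    obtain ⟨c, d, hd, e⟩ := h (1 / (p.1 ^ k : ℕ)) ⟨1, _, pow_mem_Ω.2 hk, by push_cast; rfl⟩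
    have hp0 : 0 < p.1 ^ k := pow_pos p.2.pos k
    have hv' : (v : ℝ) ≠ 0 := by positivity
    have hd' : (d : ℝ) ≠ 0 := by exact_mod_cast hd.1.ne'
    have hp' : ((p.1 ^ k : ℕ) : ℝ) ≠ 0 := by exact_mod_cast hp0.ne'
    have e' : (u : ℝ) * d = c * (v * (p.1 ^ k : ℕ)) := by
      rw [div_mul_div_comm, mul_one, div_eq_div_iff (mul_ne_zero hv' hp') hd'] at e
      exact e
    have e2 : u * d = c * (v * p.1 ^ k) := by exact_mod_cast e'
    have hc : c ≠ 0 := by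
      rintro rfl
      have := Nat.mul_pos hu hd.1
      omega
    have e3 := congrArg (fun n : ℕ => n.factorization p) e2
    simp only [Nat.factorization_mul hu.ne' hd.1.ne', Nat.factorization_mul hc
      (Nat.mul_pos hv hp0).ne', Nat.factorization_mul hv.ne' hp0.ne', Finsupp.add_apply,
      p.2.factorization_pow, Finsupp.single_eq_same] at e3
    refine le_trans ?_ (add_le_add_right (hd.2 p) (u.factorization p : ℕ∞))
    exact_mod_cast (by omega : v.factorization p + k ≤ u.factorization p + d.factorization p)
  rw [ofNat_mul_apply]
  generalize s p = t at key
  induction t using ENat.recTopCoe with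
  | top =>
    refine (ENat.eq_top_iff_forall_ge.2 fun k => ?_).ge.trans' le_top
    exact (Nat.cast_le.2 (Nat.le_add_left k _)).trans (key k le_top)
  | coe k => exact_mod_cast key k le_rfl

/-- A positive fraction that survives even the open cutoff; b > 1 is essential when r = 1. -/
lemma one_div_mem_fractions_inter_Iio {b : ℕ} (hb : b ∈ s.Ω) (h1 : 1 < b) {r : ℝ}
    (hr : 1 ≤ r) : 1 / (b : ℝ) ∈ s.fractions ∩ Set.Iio r := by
  refine ⟨⟨1, b, hb, by simp⟩, lt_of_lt_of_le ?_ hr⟩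
  have h1' : (1 : ℝ) < b := by exact_mod_cast h1
  rw [div_lt_one (by linarith)]
  exact h1'

end SteinitzNumber

/-! ### Value sets of the algebras of the list -/

namespace MeasureAlgebra

open SteinitzNumber

variable {s : SteinitzNumber}

lemma St_range_μ (n : ℕ) : Set.range (St n).μ = {x : ℝ | ∃ k : ℕ, k ≤ n ∧ x = k / n} := by
  rw [(St_hasStdFamilies n).range_μ]
  ext x
  simp [div_eq_mul_inv]

lemma tensor_Hinf_Per_range_μ (s : SteinitzNumber) :
    Set.range (tensor Hinf (Per s)).μ = s.fractions := by
  rw [(Hinf_hasStdFamilies.tensor (Per_hasStdFamilies s)).range_μ]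
  ext x
  constructor
  · rintro ⟨_, ⟨⟨n, _⟩, rfl, ⟨b, _⟩, ⟨hb, h⟩, rfl⟩, k, -, rfl⟩
    simp only at hb h
    exact ⟨k, b, hb, by simp [h, div_eq_mul_inv]⟩
  · rintro ⟨a, b, hb, rfl⟩
    exact ⟨_, ⟨(a, 1), rfl, (b, 1 / b), ⟨hb, rfl⟩, rfl⟩, a, Nat.le_mul_of_pos_right a hb.1,
      by simp [div_eq_mul_inv]⟩

/-- The unit measure is 1/(bᵢc) when mᵢ ≠ 0. It stays uncancelled because mᵢ may be 0, in which case
the family is empty. -/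
lemma cornerUnion_hasStdFamilies (ch : DivisorChain s) (m : ℕ → ℕ)
    (hm : ∀ i, m i * (ch.b (i + 1) / ch.b i) ≤ m (i + 1)) :
    ∃ S, HasStdFamilies (cornerUnion ch m hm) S ∧ ∀ p : ℕ × ℝ, p ∈ S ↔
      ∃ i, ∃ c ∈ (s.quot (ch.b i)).Ω, p = (m i * c, (m i : ℝ) / ch.b i * (1 / m i * (1 / c))) := by
  refine ⟨_, HasStdFamilies.union fun i =>
    (St_hasStdFamilies (m i)).tensor (Per_hasStdFamilies (s.quot (ch.b i))), fun p => ?_⟩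
  constructor
  · rintro ⟨i, _, ⟨_, rfl, ⟨c, _⟩, ⟨hc, h⟩, rfl⟩, rfl⟩
    simp only at hc h
    exact ⟨i, c, hc, by rw [h]⟩
  · rintro ⟨i, c, hc, rfl⟩
    exact ⟨i, _, ⟨_, rfl, (c, 1 / c), ⟨hc, rfl⟩, rfl⟩, rfl⟩

/-- Treats both cutoffs at once: P is the half-line, closed or open, and M b counts the positive
multiples of 1/b in it. Divisors of s divide some bᵢ, so the result does not depend on the chain. -/
lemma cornerUnion_range_μ (ch : DivisorChain s) {M : ℕ → ℕ}
    (hM : ∀ b k, 0 < k → M b * k ≤ M (b * k)) {P : Set ℝ}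
    (hP : ∀ b k : ℕ, 0 < b → (k ≤ M b ↔ (k : ℝ) / b ∈ P))
    (hm : ∀ i, M (ch.b i) * (ch.b (i + 1) / ch.b i) ≤ M (ch.b (i + 1))) :
    Set.range (cornerUnion ch (fun i => M (ch.b i)) hm).μ = s.fractions ∩ P := by
  obtain ⟨S, hS, hS'⟩ := cornerUnion_hasStdFamilies ch (fun i => M (ch.b i)) hm
  have hval : ∀ (i c k : ℕ), 0 < c → k ≤ M (ch.b i) * c →
      (k : ℝ) * (M (ch.b i) / ch.b i * (1 / M (ch.b i) * (1 / c))) = k / (ch.b i * c : ℕ) := by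
    intro i c k hc hk
    rcases Nat.eq_zero_or_pos (M (ch.b i)) with h | h
    · rw [h, zero_mul] at hk
      simp [Nat.le_zero.1 hk]
    · have h1 : (M (ch.b i) : ℝ) ≠ 0 := by positivity
      have h2 : (ch.b i : ℝ) ≠ 0 := by exact_mod_cast (ch.mem i).1.ne'
      have h3 : (c : ℝ) ≠ 0 := by positivity
      push_cast
      field_simp
  rw [hS.range_μ]
  ext x
  constructor
  · rintro ⟨p, hp, k, hk, rfl⟩
    obtain ⟨i, c, hc, rfl⟩ := (hS' p).1 hp
    have h1 := mul_mem_Ω (ch.mem i) hc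
    simp only at hk ⊢
    rw [hval i c k hc.1 hk]
    exact ⟨⟨k, _, h1, rfl⟩, (hP _ k h1.1).1 (hk.trans (hM _ _ hc.1))⟩
  · rintro ⟨⟨a, b, hb, rfl⟩, hx⟩
    obtain ⟨i, c, hc⟩ := ch.exists_dvd hb
    have hbi := (ch.mem i).1
    have hc0 : 0 < c := Nat.pos_of_ne_zero fun h => by rw [h] at hc; omega
    have e : (a : ℝ) / b = (a * c : ℕ) / (ch.b i : ℕ) := by
      rw [hc]
      push_cast
      rw [mul_div_mul_right _ _ (by positivity)]
    rw [e] at hx ⊢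
    have hk := (hP _ (a * c) hbi).2 hx
    -- With the denominator enlarged to bᵢ, constant sequences in the factor H(s/bᵢ) suffice, hence
    -- the divisor 1.
    refine ⟨_, (hS' _).2 ⟨i, 1, one_mem_Ω _, rfl⟩, a * c, (mul_one (M (ch.b i))).symm ▸ hk, ?_⟩
    simp only
    rw [hval i 1 (a * c) one_pos (by simpa using hk), mul_one]

lemma cornerUnion_locallyStandard (ch : DivisorChain s) (m : ℕ → ℕ)
    (hm : ∀ i, m i * (ch.b (i + 1) / ch.b i) ≤ m (i + 1))
    {x : ℝ} (hx : x ∈ Set.range (cornerUnion ch m hm).μ) (hx0 : x ≠ 0) :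
    (cornerUnion ch m hm).LocallyStandard := by
  obtain ⟨S, hS, -⟩ := cornerUnion_hasStdFamilies ch m hm
  obtain ⟨z, rfl⟩ := hx
  refine hS.locallyStandard (z := z) ?_
  rintro rfl
  exact hx0 (μ_zero _)

instance (ch : DivisorChain s) (m : ℕ → ℕ)
    (hm : ∀ i, m i * (ch.b (i + 1) / ch.b i) ≤ m (i + 1)) : Countable (cornerUnion ch m hm) := by
  unfold cornerUnion
  infer_instance

instance (r : ℝ) (ch : DivisorChain s) : Countable (Hrs r ch) := by
  unfold Hrs
  infer_instance

instance (r : ℝ) (ch : DivisorChain s) : Countable (HrsPlus r ch) := by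
  unfold HrsPlus
  infer_instance

lemma Hrs_range_μ {r : ℝ} (hr : 1 ≤ r) (ch : DivisorChain s) :
    Set.range (Hrs r ch).μ = s.fractions ∩ Set.Iic r := by
  refine cornerUnion_range_μ ch (M := mClosed r) (fun b k _ => mClosed_le r b k) ?_ _
  intro b k hb
  have hb' : (0 : ℝ) < b := by exact_mod_cast hb
  rw [mClosed, Nat.le_floor_iff (by positivity), Set.mem_Iic, div_le_iff₀ hb']

lemma HrsPlus_range_μ {r : ℝ} (hr : 1 ≤ r) (ch : DivisorChain s) :
    Set.range (HrsPlus r ch).μ = s.fractions ∩ Set.Iio r := by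
  refine cornerUnion_range_μ ch (M := mOpen r) (fun b k hk => mOpen_le r b hk) ?_ _
  intro b k hb
  have hb' : (0 : ℝ) < b := by exact_mod_cast hb
  have hrb : 0 < r * b := by positivity
  rw [Set.mem_Iio, div_lt_iff₀ hb', mOpen]
  split_ifs with h
  · obtain ⟨n, hn⟩ := h
    rw [hn] at hrb ⊢
    -- Positivity makes k ≤ n - 1 equivalent to k < n in spite of truncated subtraction.
    have hn0 : 0 < n := by exact_mod_cast hrb
    rw [Nat.floor_natCast, Nat.cast_lt]
    omega
  · rw [Nat.le_floor_iff hrb.le]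
    exact ⟨fun h' => lt_of_le_of_ne h' fun e => h ⟨k, e.symm⟩, le_of_lt⟩

end MeasureAlgebra

/-! ### The list consists of countable locally standard algebras -/

namespace ListEntry

open MeasureAlgebra SteinitzNumber

theorem countable_algebra (L : ListEntry) : Countable L.algebra := by
  cases L
  · exact inferInstanceAs (Countable (St _))
  · exact inferInstanceAs (Countable (tensor Hinf (Per _)))
  · exact inferInstanceAs (Countable (Hrs _ _))
  · exact inferInstanceAs (Countable (HrsPlus _ _))

theorem locallyStandard_algebra (L : ListEntry) : L.algebra.LocallyStandard := by
  cases L with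
  | st n hn =>
    refine (St_hasStdFamilies n).locallyStandard (z := stBasis n ⟨0, hn⟩) fun h => ?_
    have h1 := (stBasis_isStdFamily n).meas ⟨0, hn⟩
    rw [h, μ_zero] at h1
    have : (0 : ℝ) < 1 / n := by positivity
    exact this.ne h1
  | inf s =>
    obtain ⟨z, hz⟩ : (1 : ℝ) ∈ Set.range (tensor Hinf (Per s)).μ := by
      rw [tensor_Hinf_Per_range_μ]
      exact ⟨1, 1, one_mem_Ω s, by simp⟩
    refine (Hinf_hasStdFamilies.tensor (Per_hasStdFamilies s)).locallyStandard (z := z) ?_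
    rintro rfl
    rw [μ_zero] at hz
    exact zero_ne_one hz
  | closed r hr s hs ch =>
    obtain ⟨b, hb, h1⟩ := hs.exists_lt 1
    have hx : 1 / (b : ℝ) ∈ Set.range (Hrs r ch).μ := by
      rw [Hrs_range_μ hr ch]
      exact Set.inter_subset_inter_right _ Set.Iio_subset_Iic_self
        (one_div_mem_fractions_inter_Iio hb h1 hr)
    change (Hrs r ch).LocallyStandard
    unfold Hrs at hx ⊢
    exact cornerUnion_locallyStandard ch _ _ hx (by positivity)
  | plus r hr s hs ch =>
    obtain ⟨b, hb, h1⟩ := hs.exists_lt 1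
    have hx : 1 / (b : ℝ) ∈ Set.range (HrsPlus r ch).μ := by
      rw [HrsPlus_range_μ hr ch]
      exact one_div_mem_fractions_inter_Iio hb h1 hr
    change (HrsPlus r ch).LocallyStandard
    unfold HrsPlus at hx ⊢
    exact cornerUnion_locallyStandard ch _ _ hx (by positivity)

end ListEntry

/-! ### Classification of value sets -/

/-- The property of the sets of values of locally standard measures: any two values are among the
multiples `0, ε, …, n ε` of some `ε > 0`, all of which are values. -/
def IsValueSet (D : Set ℝ) : Prop :=
  ∀ x ∈ D, ∀ y ∈ D, ∃ ε : ℝ, 0 < ε ∧ ∃ n j k : ℕ, j ≤ n ∧ k ≤ n ∧ x = j * ε ∧ y = k * ε ∧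
    ∀ i : ℕ, i ≤ n → (i : ℝ) * ε ∈ D

lemma MeasureAlgebra.LocallyStandard.isValueSet {H : MeasureAlgebra.{u}} (h : H.LocallyStandard) :
    IsValueSet (Set.range H.μ) := by
  rintro _ ⟨a, rfl⟩ _ ⟨b, rfl⟩
  obtain ⟨n, -, ε, hε, e, he, T, T', rfl, rfl⟩ := h.exists_common_family a b
  refine ⟨ε, hε, n, T.card, T'.card, by simpa using T.card_le_univ, by simpa using T'.card_le_univ,
    he.μ_sum T, he.μ_sum T', fun i hi => ?_⟩
  obtain ⟨U, -, rfl⟩ := Finset.exists_subset_card_eq (s := (Finset.univ : Finset (Fin n)))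
    (n := i) (by simpa using hi)
  exact ⟨_, he.μ_sum U⟩

lemma MeasureAlgebra.LocallyStandard.exists_pos {H : MeasureAlgebra.{u}} (h : H.LocallyStandard) :
    ∃ d ∈ Set.range H.μ, 0 < d := by
  obtain ⟨n, hn, ε, hε, e, he, -⟩ := h.exists_family Set.finite_empty
  exact ⟨ε, ⟨e ⟨0, hn⟩, he.meas _⟩, hε⟩

namespace IsValueSet

open SteinitzNumber

variable {D : Set ℝ}

lemma smul (hD : IsValueSet D) {c : ℝ} (hc : 0 < c) : IsValueSet ((fun x => c * x) '' D) := by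
  rintro _ ⟨x, hx, rfl⟩ _ ⟨y, hy, rfl⟩
  obtain ⟨ε, hε, n, j, k, hj, hk, rfl, rfl, h⟩ := hD x hx y hy
  exact ⟨c * ε, mul_pos hc hε, n, j, k, hj, hk, by ring, by ring,
    fun i hi => ⟨_, h i hi, by ring⟩⟩

/-- With 1/b = jε and d = lε, the number k/b = kjε is one of the multiples of ε up to lε, all of
which are values. -/
lemma div_mem (hD : IsValueSet D) {b : ℕ} (hb : 1 / (b : ℝ) ∈ D) {d : ℝ} (hd : d ∈ D) {k : ℕ}
    (hk : (k : ℝ) / b ≤ d) : (k : ℝ) / b ∈ D := by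
  obtain ⟨ε, hε, n, j, l, -, hl, h1, rfl, h⟩ := hD _ hb d hd
  have e : (k : ℝ) / b = (k * j : ℕ) * ε := by
    rw [← mul_one_div, h1]
    push_cast
    ring
  rw [e] at hk ⊢
  have : k * j ≤ l := by exact_mod_cast le_of_mul_le_mul_right hk hε
  exact h _ (this.trans hl)

/-- s is the least common multiple of the set B of all b with 1/b ∈ D. As B is closed under divisors
and directed under divisibility, Ω(s) adds nothing to B. Comparing d ∈ D with 1 gives d = k/j with j
∈ B. -/
lemma exists_steinitz (hD : IsValueSet D) (h1 : (1 : ℝ) ∈ D) :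
    ∃ s : SteinitzNumber, (∀ b ∈ s.Ω, 1 / (b : ℝ) ∈ D) ∧ D ⊆ s.fractions := by
  let B : Set ℕ := {b | 0 < b ∧ 1 / (b : ℝ) ∈ D}
  have hne : Nonempty B := ⟨⟨1, one_pos, by simpa using h1⟩⟩
  have hdvd : ∀ b ∈ B, ∀ c, c ∣ b → c ∈ B := by
    rintro b ⟨hb0, hb⟩ c ⟨k, rfl⟩
    have hc0 : 0 < c := Nat.pos_of_mul_pos_right hb0
    have hk0 : 0 < k := Nat.pos_of_mul_pos_left hb0
    have hc' : (1 : ℝ) ≤ c := by exact_mod_cast hc0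
    have hk' : (k : ℝ) ≠ 0 := by positivity
    have e : 1 / (c : ℝ) = k / (c * k : ℕ) := by
      push_cast
      field_simp
    refine ⟨hc0, ?_⟩
    rw [e]
    refine hD.div_mem hb h1 ?_
    rw [← e, div_le_one (by positivity)]
    exact hc'
  let s : SteinitzNumber := fun p => ⨆ b : B, ((b : ℕ).factorization p : ℕ∞)
  have hBs : ∀ b ∈ B, b ∈ s.Ω := fun b hb =>
    ⟨hb.1, fun p => le_iSup (fun b : B => ((b : ℕ).factorization p : ℕ∞)) ⟨b, hb⟩⟩
  have hdir : ∀ b c : B, ∃ e : B, b.1 ∣ e.1 ∧ c.1 ∣ e.1 := by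
    rintro ⟨b, hb0, hb⟩ ⟨c, hc0, hc⟩
    obtain ⟨ε, hε, n, j, k, hj, hk, e1, e2, h⟩ := hD _ hb _ hc
    have hb' : (0 : ℝ) < b := by exact_mod_cast hb0
    have hc' : (0 : ℝ) < c := by exact_mod_cast hc0
    have e3 : ((b * j : ℕ) : ℝ) * ε = 1 := by
      push_cast
      rw [mul_assoc, ← e1, mul_one_div_cancel hb'.ne']
    have e4 : ((c * k : ℕ) : ℝ) * ε = 1 := by
      push_cast
      rw [mul_assoc, ← e2, mul_one_div_cancel hc'.ne']
    have e5 : b * j = c * k := by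
      have := mul_right_cancel₀ hε.ne' (e3.trans e4.symm)
      exact_mod_cast this
    have hj0 : 0 < j := by
      rcases Nat.eq_zero_or_pos j with rfl | h
      · simp at e3
      · exact h
    -- The common multiple is bj = ck, whose reciprocal is ε itself, a value.
    refine ⟨⟨b * j, Nat.mul_pos hb0 hj0, ?_⟩, Dvd.intro _ rfl, Dvd.intro _ e5.symm⟩
    have e6 := h 1 (hj0.trans_le hj)
    rwa [Nat.cast_one, one_mul, eq_one_div_of_mul_eq_one_right e3] at e6
  refine ⟨s, fun b hb => ?_, fun d hd => ?_⟩
  · obtain ⟨i, hi⟩ := exists_dvd_of_mem_Ω (fun i : B => i.2.1) hdir (fun p => le_rfl) hb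
    exact (hdvd _ i.2 b hi).2
  · obtain ⟨ε, hε, n, j, k, hj, hk, e1, e2, h⟩ := hD 1 h1 d hd
    have hj0 : 0 < j := by
      rcases Nat.eq_zero_or_pos j with rfl | h
      · simp at e1
      · exact h
    have e3 : ε = 1 / (j : ℝ) := eq_one_div_of_mul_eq_one_right e1.symm
    have e4 := h 1 (hj0.trans_le hj)
    rw [Nat.cast_one, one_mul, e3] at e4
    exact ⟨k, j, hBs j ⟨hj0, e4⟩, by rw [e2, e3, mul_one_div]⟩

/-- A value set that contains `1` is, up to scaling, the set of values of an entry of the list. -/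
lemma exists_listEntry_of_one_mem (hD : IsValueSet D) (h1 : (1 : ℝ) ∈ D) :
    ∃ L : ListEntry, ∃ α : ℝ, 0 < α ∧ Set.range L.algebra.μ = (fun x => α * x) '' D := by
  obtain ⟨s, hs1, hs2⟩ := hD.exists_steinitz h1
  -- D is an initial segment of the fractions of s, so only its upper end remains to be discussed.
  have hdown : ∀ x ∈ s.fractions, ∀ d ∈ D, x ≤ d → x ∈ D := by
    rintro _ ⟨a, b, hb, rfl⟩ d hd hx
    exact hD.div_mem (hs1 b hb) hd hx
  have hone : (fun x : ℝ => 1 * x) '' D = D := by simp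
  by_cases hbd : BddAbove D
  · by_cases hinf : s.IsInfinite
    · obtain ⟨ch⟩ := exists_divisorChain s
      have hr : 1 ≤ sSup D := le_csSup hbd h1
      by_cases hmem : sSup D ∈ D
      · refine ⟨.closed (sSup D) hr s hinf ch, 1, one_pos, ?_⟩
        rw [hone]
        refine (MeasureAlgebra.Hrs_range_μ hr ch).trans (Set.Subset.antisymm ?_ ?_)
        · exact fun x hx => hdown x hx.1 _ hmem hx.2
        · exact fun x hx => ⟨hs2 hx, le_csSup hbd hx⟩
      · refine ⟨.plus (sSup D) hr s hinf ch, 1, one_pos, ?_⟩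
        rw [hone]
        refine (MeasureAlgebra.HrsPlus_range_μ hr ch).trans (Set.Subset.antisymm ?_ ?_)
        · intro x hx
          obtain ⟨d, hd, hxd⟩ := exists_lt_of_lt_csSup ⟨1, h1⟩ hx.2
          exact hdown x hx.1 d hd hxd.le
        · exact fun x hx => ⟨hs2 hx, lt_of_le_of_ne (le_csSup hbd hx) fun h => hmem (h ▸ hx)⟩
    -- For s = n the set D consists of the k/n with k ≤ m, where m/n is its maximum; the factor n/m
    -- turns it into the value set of `St m`.
    · unfold SteinitzNumber.IsInfinite at hinf
      push Not at hinf
      obtain ⟨n, hn, rfl⟩ := hinf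
      have hn' : (0 : ℝ) < n := by exact_mod_cast hn
      have hnD : 1 / (n : ℝ) ∈ D := hs1 n ⟨hn, fun p => le_rfl⟩
      have hform : ∀ x ∈ D, ∃ k : ℕ, x = k / n := by
        intro x hx
        obtain ⟨a, b, hb, rfl⟩ := hs2 hx
        obtain ⟨c, hc⟩ : b ∣ n := (Nat.factorization_le_iff_dvd hb.1.ne' hn.ne').1 fun p => by
          by_cases hp : p.Prime
          · exact Nat.cast_le.1 (hb.2 ⟨p, hp⟩)
          · simp [Nat.factorization_eq_zero_of_not_prime _ hp]
        have hc0 : 0 < c := Nat.pos_of_ne_zero fun h => by rw [h] at hc; omega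
        refine ⟨a * c, ?_⟩
        rw [hc]
        push_cast
        rw [mul_div_mul_right _ _ (by positivity)]
      obtain ⟨w, hw⟩ := hbd
      have hfin : {k : ℕ | (k : ℝ) / n ∈ D}.Finite := by
        refine (Set.finite_Iic ⌊w * n⌋₊).subset fun k hk => Nat.le_floor ?_
        exact (div_le_iff₀ hn').1 (hw hk)
      have hnmem : n ∈ {k : ℕ | (k : ℝ) / n ∈ D} := by
        change (n : ℝ) / n ∈ D
        rwa [div_self hn'.ne']
      obtain ⟨m, hm, hmax⟩ := hfin.exists_maximalFor id _ ⟨n, hnmem⟩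
      have hle : ∀ k ∈ {k : ℕ | (k : ℝ) / n ∈ D}, k ≤ m := fun k hk => by
        rcases le_total k m with h | h
        · exact h
        · exact hmax hk h
      have hm0 : 0 < m := hn.trans_le (hle n hnmem)
      have hm' : (0 : ℝ) < m := by exact_mod_cast hm0
      refine ⟨.st m hm0, n / m, by positivity, (MeasureAlgebra.St_range_μ m).trans ?_⟩
      ext x
      constructor
      · rintro ⟨k, hk, rfl⟩
        refine ⟨k / n, hD.div_mem hnD hm ?_, ?_⟩
        · gcongr
        · field_simp
      · rintro ⟨x, hx, rfl⟩
        obtain ⟨k, rfl⟩ := hform x hx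
        exact ⟨k, hle k hx, by field_simp⟩
  -- Without an upper bound every fraction lies below some value, whether or not s is infinite.
  · refine ⟨.inf s, 1, one_pos, ?_⟩
    rw [hone]
    refine (MeasureAlgebra.tensor_Hinf_Per_range_μ s).trans (Set.Subset.antisymm ?_ hs2)
    intro x hx
    rw [not_bddAbove_iff] at hbd
    obtain ⟨d, hd, hxd⟩ := hbd x
    exact hdown x hx d hd hxd.le

lemma exists_listEntry (hD : IsValueSet D) {d : ℝ} (hd : d ∈ D) (hd0 : 0 < d) :
    ∃ L : ListEntry, ∃ α : ℝ, 0 < α ∧ Set.range L.algebra.μ = (fun x => α * x) '' D := by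
  obtain ⟨L, α, hα, h⟩ := (hD.smul (inv_pos.2 hd0)).exists_listEntry_of_one_mem
    ⟨d, hd, inv_mul_cancel₀ hd0.ne'⟩
  refine ⟨L, α * d⁻¹, by positivity, ?_⟩
  rw [h, Set.image_image]
  simp only [mul_assoc]

end IsValueSet

/-! ### Proportionality of value sets -/

namespace SteinitzNumber

variable {s s' : SteinitzNumber} {r r' α : ℝ} {P P' : Set ℝ}

lemma one_mem_fractions (s : SteinitzNumber) : (1 : ℝ) ∈ s.fractions :=
  ⟨1, 1, MeasureAlgebra.one_mem_Ω s, by simp⟩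

/-- The image of 1 is a fraction u/v, so α is rational; the two inclusions then give the two
divisibilities between vs and us'. -/
lemma exists_ratio_of_scale (hα : 0 < α) (h1 : ∀ x ∈ s.fractions, α * x ∈ s'.fractions)
    (h2 : ∀ x ∈ s'.fractions, α⁻¹ * x ∈ s.fractions) :
    ∃ u v : ℕ, 0 < u ∧ 0 < v ∧ α = u / v ∧ ofNat v * s = ofNat u * s' := by
  obtain ⟨u, v, hv, e⟩ := h1 1 (one_mem_fractions s)
  rw [mul_one] at e
  have hu : 0 < u := by
    rcases Nat.eq_zero_or_pos u with rfl | h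
    · simp [e] at hα
    · exact h
  refine ⟨u, v, hu, hv.1, e, funext fun p => le_antisymm ?_ ?_⟩
  · exact le_of_scale_fractions hu hv.1 (fun x hx => e ▸ h1 x hx) p
  · refine le_of_scale_fractions hv.1 hu (fun x hx => ?_) p
    have h3 := h2 x hx
    rwa [e, inv_div] at h3

lemma scale_mem_fractions_iff {u v : ℕ} (hu : 0 < u) (hv : 0 < v)
    (h : ofNat v * s = ofNat u * s') (x : ℝ) :
    (u : ℝ) / v * x ∈ s'.fractions ↔ x ∈ s.fractions := by
  refine ⟨fun hx => ?_, scale_fractions hu hv fun p => (congrFun h p).le⟩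
  have h1 := scale_fractions hv hu (fun p => (congrFun h p).ge) hx
  have hu' : (u : ℝ) ≠ 0 := by positivity
  have hv' : (v : ℝ) ≠ 0 := by positivity
  rwa [← mul_assoc, div_mul_div_cancel₀ hu', div_self hv', one_mul] at h1

lemma image_fractions_inter {u v : ℕ} (hu : 0 < u) (hv : 0 < v) (h : ofNat v * s = ofNat u * s')
    (hP : ∀ x ∈ s.fractions, (u : ℝ) / v * x ∈ P' ↔ x ∈ P) :
    s'.fractions ∩ P' = (fun x => (u : ℝ) / v * x) '' (s.fractions ∩ P) := by
  ext y
  constructor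
  · rintro ⟨h1, h2⟩
    have hu' : (u : ℝ) ≠ 0 := by positivity
    have hv' : (v : ℝ) ≠ 0 := by positivity
    have e : (u : ℝ) / v * (v / u * y) = y := by field_simp
    rw [← e] at h1 h2
    have h3 := (scale_mem_fractions_iff hu hv h _).1 h1
    exact ⟨v / u * y, ⟨h3, (hP _ h3).1 h2⟩, e⟩
  · rintro ⟨x, ⟨h1, h2⟩, rfl⟩
    exact ⟨(scale_mem_fractions_iff hu hv h x).2 h1, (hP x h1).2 h2⟩

/-- The cutoff loses no information about s: every fraction is a natural multiple of some 1/l with l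
∈ Ω(s) and l > 1, which lies below r, and fractions are closed under natural multiples. -/
lemma scale_mem_of_scale_mem_inter (hs : s.IsInfinite) (hr : 1 ≤ r) (hP : Set.Iio r ⊆ P)
    (h : ∀ x ∈ s.fractions ∩ P, α * x ∈ s'.fractions) (x : ℝ) (hx : x ∈ s.fractions) :
    α * x ∈ s'.fractions := by
  obtain ⟨a, b, hb, rfl⟩ := hx
  obtain ⟨c, hc, hc1⟩ := hs.exists_lt 1
  have hl := lcm_mem hb hc
  have hcl : c ≤ b.lcm c := Nat.le_of_dvd hl.1 (Nat.dvd_lcm_right b c)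
  obtain ⟨k, hk⟩ := Nat.dvd_lcm_left b c
  have h1 := one_div_mem_fractions_inter_Iio hl (hc1.trans_le hcl) hr
  have h2 := nat_mul_mem_fractions (h _ ⟨h1.1, hP h1.2⟩) (a * k)
  have hk0 : 0 < k := Nat.pos_of_ne_zero fun h => by
    have := hl.1
    rw [hk, h] at this
    omega
  have hb' : (b : ℝ) ≠ 0 := by exact_mod_cast hb.1.ne'
  have hk' : (k : ℝ) ≠ 0 := by positivity
  convert h2 using 1
  rw [hk]
  push_cast
  field_simp

/-- Ω(s) is unbounded, so fractions come arbitrarily close to r from below, even if r is not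
attained. -/
lemma isLUB_fractions_inter (hs : s.IsInfinite) (hr : 1 ≤ r) (hP : Set.Iio r ⊆ P)
    (hP' : P ⊆ Set.Iic r) : IsLUB (s.fractions ∩ P) r := by
  refine ⟨fun x hx => hP' hx.2, fun w hw => ?_⟩
  by_contra! hlt
  have hw0 : max w 0 < r := max_lt hlt (by linarith)
  obtain ⟨N, hN⟩ := exists_nat_gt (r - max w 0)⁻¹
  obtain ⟨b, hb, hNb⟩ := hs.exists_lt N
  have hδ : 0 < r - max w 0 := by linarith
  have hb' : (0 : ℝ) < b := by exact_mod_cast hb.1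
  -- The interval from max(w, 0) to r is longer than 1/b, so the first multiple of 1/b beyond max(w,
  -- 0) is still below r. The maximum with 0 keeps the natural floor exact.
  have h1 : 1 < (r - max w 0) * b := by
    rw [← div_lt_iff₀' hδ, one_div]
    exact hN.trans (by exact_mod_cast hNb)
  have h2 := Nat.lt_floor_add_one (max w 0 * b)
  have h3 := Nat.floor_le (a := max w 0 * b) (by positivity)
  have h4 : ((⌊max w 0 * b⌋₊ + 1 : ℕ) : ℝ) / b < r := by
    rw [div_lt_iff₀ hb']
    push_cast
    linarith
  have h5 := hw ⟨⟨_, b, hb, rfl⟩, hP h4⟩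
  have h6 : max w 0 < ((⌊max w 0 * b⌋₊ + 1 : ℕ) : ℝ) / b := by
    rw [lt_div_iff₀ hb']
    push_cast
    exact h2
  exact absurd h5 (not_le.2 ((le_max_left w 0).trans_lt h6))

lemma infinite_fractions_inter (hs : s.IsInfinite) (hr : 1 ≤ r) (hP : Set.Iio r ⊆ P) :
    (s.fractions ∩ P).Infinite := by
  have hinf : (s.Ω ∩ Set.Ioi 1).Infinite := by
    refine Set.infinite_of_not_bddAbove fun ⟨N, hN⟩ => ?_
    obtain ⟨b, hb, hlt⟩ := hs.exists_lt (max N 1)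
    exact absurd (hN ⟨hb, (le_max_right N 1).trans_lt hlt⟩)
      (not_le.2 ((le_max_left N 1).trans_lt hlt))
  refine Set.infinite_of_injOn_mapsTo (f := fun b : ℕ => 1 / (b : ℝ)) ?_ ?_ hinf
  · intro b _ c _ h
    simpa using h
  · intro b hb
    have := one_div_mem_fractions_inter_Iio hb.1 hb.2 hr
    exact ⟨this.1, hP this.2⟩

/-- Comparing suprema gives r' = αr, and comparing fractions gives α = u/v with vs = us'. The sets P
and P' are only pinned between the open and the closed half-line, so that all combinations are
covered. -/
lemma rescale_of_image_eq (hs : s.IsInfinite) (hs' : s'.IsInfinite) (hr : 1 ≤ r) (hr' : 1 ≤ r')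
    (hP₁ : Set.Iio r ⊆ P) (hP₂ : P ⊆ Set.Iic r) (hP₁' : Set.Iio r' ⊆ P') (hP₂' : P' ⊆ Set.Iic r')
    (hα : 0 < α) (h : s'.fractions ∩ P' = (fun x => α * x) '' (s.fractions ∩ P)) :
    r' = α * r ∧ ListEntry.Rescale r s r' s' := by
  have hlub := (isLUB_fractions_inter hs hr hP₁ hP₂)
  have hr'' : r' = α * r := by
    refine (isLUB_fractions_inter hs' hr' hP₁' hP₂').unique ?_
    rw [h]
    exact (OrderIso.mulLeft₀ α hα).isLUB_image'.2 hlub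
  obtain ⟨u, v, hu, hv, e, huv⟩ := exists_ratio_of_scale (s := s) (s' := s') hα
    (scale_mem_of_scale_mem_inter hs hr hP₁ fun x hx => (h.ge ⟨x, hx, rfl⟩).1)
    (scale_mem_of_scale_mem_inter hs' hr' hP₁' fun y hy => by
      obtain ⟨x, hx, rfl⟩ := h.le hy
      simp only
      rw [inv_mul_cancel_left₀ hα.ne']
      exact hx.1)
  refine ⟨hr'', u, v, hu, hv, huv, ?_⟩
  have hv' : (v : ℝ) ≠ 0 := by positivity
  rw [hr'', e]
  field_simp

lemma notMem_fractions_iff {x : ℝ} : x ∉ s.fractions ↔ ∀ a : ℕ, ∀ b ∈ s.Ω, x ≠ (a : ℝ) / b := by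
  simp [fractions]

lemma fractions_inter_Iic_of_notMem (h : r ∉ s.fractions) :
    s.fractions ∩ Set.Iic r = s.fractions ∩ Set.Iio r := by
  ext x
  exact ⟨fun hx => ⟨hx.1, lt_of_le_of_ne hx.2 fun e : x = r => h (e ▸ hx.1)⟩,
    fun hx => ⟨hx.1, Set.Iio_subset_Iic_self hx.2⟩⟩

/-- Proportionality of the sets `D` and `D'`. -/
def Proportional (D D' : Set ℝ) : Prop := ∃ α : ℝ, 0 < α ∧ D' = (fun x => α * x) '' D

lemma Proportional.symm {D D' : Set ℝ} (h : Proportional D D') : Proportional D' D := by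
  obtain ⟨α, hα, rfl⟩ := h
  refine ⟨α⁻¹, inv_pos.2 hα, ?_⟩
  simp [Set.image_image, hα.ne']

lemma Proportional.finite {D D' : Set ℝ} (h : Proportional D D') (hD : D.Finite) : D'.Finite := by
  obtain ⟨α, hα, rfl⟩ := h
  exact hD.image _

lemma Proportional.bddAbove {D D' : Set ℝ} (h : Proportional D D') (hD : BddAbove D) :
    BddAbove D' := by
  obtain ⟨α, hα, rfl⟩ := h
  exact (monotone_mul_left_of_nonneg hα.le).map_bddAbove hD

lemma proportional_fractions_iff : Proportional s.fractions s'.fractions ↔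
    ∃ u v : ℕ, 0 < u ∧ 0 < v ∧ ofNat v * s = ofNat u * s' := by
  constructor
  · rintro ⟨α, hα, h⟩
    obtain ⟨u, v, hu, hv, -, huv⟩ := exists_ratio_of_scale (s := s) (s' := s') hα
      (fun x hx => h.ge ⟨x, hx, rfl⟩) (fun y hy => by
        obtain ⟨x, hx, rfl⟩ := h.le hy
        simp only
        rwa [inv_mul_cancel_left₀ hα.ne'])
    exact ⟨u, v, hu, hv, huv⟩
  · rintro ⟨u, v, hu, hv, h⟩
    refine ⟨u / v, by positivity, ?_⟩
    simpa using image_fractions_inter (P := Set.univ) (P' := Set.univ) hu hv h (by simp)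

lemma proportional_Iic_iff (hs : s.IsInfinite) (hs' : s'.IsInfinite) (hr : 1 ≤ r) (hr' : 1 ≤ r') :
    Proportional (s.fractions ∩ Set.Iic r) (s'.fractions ∩ Set.Iic r') ↔
      ListEntry.Rescale r s r' s' := by
  constructor
  · rintro ⟨α, hα, h⟩
    exact (rescale_of_image_eq hs hs' hr hr' Set.Iio_subset_Iic_self subset_rfl
      Set.Iio_subset_Iic_self subset_rfl hα h).2
  · rintro ⟨u, v, hu, hv, h, e⟩
    have hv' : (0 : ℝ) < v := by positivity
    have hu' : (0 : ℝ) < u := by positivity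
    refine ⟨u / v, by positivity, image_fractions_inter hu hv h fun x _ => ?_⟩
    have e' : r' = u / v * r := by field_simp; linarith
    rw [Set.mem_Iic, Set.mem_Iic, e', mul_le_mul_iff_right₀ (by positivity)]

lemma proportional_Iio_iff (hs : s.IsInfinite) (hs' : s'.IsInfinite) (hr : 1 ≤ r) (hr' : 1 ≤ r') :
    Proportional (s.fractions ∩ Set.Iio r) (s'.fractions ∩ Set.Iio r') ↔
      ListEntry.Rescale r s r' s' := by
  constructor
  · rintro ⟨α, hα, h⟩
    exact (rescale_of_image_eq hs hs' hr hr' subset_rfl Set.Iio_subset_Iic_self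
      subset_rfl Set.Iio_subset_Iic_self hα h).2
  · rintro ⟨u, v, hu, hv, h, e⟩
    have hv' : (0 : ℝ) < v := by positivity
    have hu' : (0 : ℝ) < u := by positivity
    refine ⟨u / v, by positivity, image_fractions_inter hu hv h fun x _ => ?_⟩
    have e' : r' = u / v * r := by field_simp; linarith
    rw [Set.mem_Iio, Set.mem_Iio, e', mul_lt_mul_iff_right₀ (by positivity)]

/-- If r is a fraction, the closed set has it as its maximum, and its image αr = r' would have to
lie below r'. Otherwise the closed and the open cutoff coincide. -/
lemma proportional_Iic_Iio_iff (hs : s.IsInfinite) (hs' : s'.IsInfinite) (hr : 1 ≤ r)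
    (hr' : 1 ≤ r') : Proportional (s.fractions ∩ Set.Iic r) (s'.fractions ∩ Set.Iio r') ↔
      ListEntry.Rescale r s r' s' ∧ r ∉ s.fractions := by
  constructor
  · rintro ⟨α, hα, h⟩
    obtain ⟨e, h1⟩ := rescale_of_image_eq hs hs' hr hr' Set.Iio_subset_Iic_self subset_rfl
      subset_rfl Set.Iio_subset_Iic_self hα h
    refine ⟨h1, fun hmem => ?_⟩
    have h2 := (h.ge ⟨r, ⟨hmem, le_refl r⟩, rfl⟩).2
    exact absurd e.le (not_le.2 h2)
  · rintro ⟨h, hmem⟩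
    rw [fractions_inter_Iic_of_notMem hmem]
    exact (proportional_Iio_iff hs hs' hr hr').2 h

end SteinitzNumber

/-! ### Comparison of list entries and the main theorem -/

namespace ListEntry

open MeasureAlgebra SteinitzNumber

lemma Rescale.mem_fractions_iff {r r' : ℝ} {s s' : SteinitzNumber}
    (h : Rescale r s r' s') :
    r' ∈ s'.fractions ↔ r ∈ s.fractions := by
  obtain ⟨u, v, hu, hv, h, e⟩ := h
  have hv' : (0 : ℝ) < v := by positivity
  have e' : r' = u / v * r := by field_simp; linarith
  rw [e', scale_mem_fractions_iff hu hv h]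

lemma Rescale.symm {r r' : ℝ} {s s' : SteinitzNumber}
    (h : Rescale r s r' s') : Rescale r' s' r s := by
  obtain ⟨u, v, hu, hv, h, e⟩ := h
  exact ⟨v, u, hv, hu, h.symm, e.symm⟩

lemma St_range_μ_eq_image (n : ℕ) :
    Set.range (St n).μ = (fun k : ℕ => (k : ℝ) / n) '' Set.Iic n := by
  rw [St_range_μ]
  ext x
  exact ⟨fun ⟨k, hk, e⟩ => ⟨k, hk, e.symm⟩, fun ⟨k, hk, e⟩ => ⟨k, hk, e.symm⟩⟩

lemma ncard_range_St {n : ℕ} (hn : 1 ≤ n) : (Set.range (St n).μ).ncard = n + 1 := by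
  have hn' : (n : ℝ) ≠ 0 := by positivity
  rw [St_range_μ_eq_image, Set.ncard_image_of_injective]
  · rw [← Finset.coe_Iic, Set.ncard_coe_finset, Nat.card_Iic]
  · intro a b h
    exact_mod_cast (div_left_inj' hn').1 h

lemma finite_range_St (n : ℕ) : (Set.range (St n).μ).Finite := by
  rw [St_range_μ_eq_image]
  exact (Set.finite_Iic n).image _

lemma not_bddAbove_fractions (s : SteinitzNumber) : ¬ BddAbove s.fractions := by
  rintro ⟨w, hw⟩
  obtain ⟨N, hN⟩ := exists_nat_gt w
  exact absurd (hw ⟨N, 1, one_mem_Ω s, by simp⟩) (not_le.2 hN)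

/-- Finiteness and boundedness, both invariant under scaling, separate the types: finite for `st`,
unbounded for `inf`, bounded and infinite for the two remaining ones. Among the `st` entries the
cardinality n + 1 decides. -/
lemma proportional_iff_same (L L' : ListEntry) :
    Proportional (Set.range L.algebra.μ) (Set.range L'.algebra.μ) ↔ L.Same L' := by
  have hst : ∀ {n D}, D.Infinite → ¬ Proportional (Set.range (St n).μ) D := fun hD h =>
    hD (h.finite (finite_range_St _))
  have hinf : ∀ {s D}, BddAbove D → ¬ Proportional (SteinitzNumber.fractions s) D := fun hD h =>
    not_bddAbove_fractions _ (h.symm.bddAbove hD)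
  have hfr : ∀ s, (SteinitzNumber.fractions s).Infinite := fun s h =>
    not_bddAbove_fractions s h.bddAbove
  rcases L with ⟨n, hn⟩ | s | ⟨r, hr, s, hs, ch⟩ | ⟨r, hr, s, hs, ch⟩ <;>
    rcases L' with ⟨n', hn'⟩ | s' | ⟨r', hr', s', hs', ch'⟩ | ⟨r', hr', s', hs', ch'⟩ <;>
    simp (disch := assumption) only [algebra, Same, tensor_Hinf_Per_range_μ, Hrs_range_μ,
      HrsPlus_range_μ, iff_false]
  · constructor
    · rintro ⟨α, hα, h⟩
      have h1 := congrArg Set.ncard h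
      rw [Set.ncard_image_of_injective _ (mul_right_injective₀ hα.ne'), ncard_range_St hn,
        ncard_range_St hn'] at h1
      omega
    · rintro rfl
      exact ⟨1, one_pos, by simp⟩
  · exact hst (hfr _)
  · exact hst (infinite_fractions_inter hs' hr' Set.Iio_subset_Iic_self)
  · exact hst (infinite_fractions_inter hs' hr' subset_rfl)
  · exact fun h => hst (hfr _) h.symm
  · exact proportional_fractions_iff
  · exact hinf ⟨r', fun x hx => hx.2⟩
  · exact hinf ⟨r', fun x hx => le_of_lt hx.2⟩
  · exact fun h => hst (infinite_fractions_inter hs hr Set.Iio_subset_Iic_self) h.symm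
  · exact fun h => hinf ⟨r, fun x hx => hx.2⟩ h.symm
  · exact proportional_Iic_iff hs hs' hr hr'
  · rw [← notMem_fractions_iff]
    exact proportional_Iic_Iio_iff hs hs' hr hr'
  · exact fun h => hst (infinite_fractions_inter hs hr subset_rfl) h.symm
  · exact fun h => hinf ⟨r, fun x hx => le_of_lt hx.2⟩ h.symm
  -- Reduced by symmetry to the closed–open case. The condition then concerns r' and s' in place of
  -- r and s, which rescaling shows to be equivalent.
  · rw [← notMem_fractions_iff]
    constructor
    · intro h
      obtain ⟨h1, h2⟩ := (proportional_Iic_Iio_iff hs' hs hr' hr).1 h.symm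
      exact ⟨h1.symm, fun h3 => h2 (h1.mem_fractions_iff.1 h3)⟩
    · rintro ⟨h1, h2⟩
      exact ((proportional_Iic_Iio_iff hs' hs hr' hr).2 ⟨h1.symm,
        fun h3 => h2 (h1.mem_fractions_iff.1 h3)⟩).symm
  · exact proportional_Iio_iff hs hs' hr hr'

end ListEntry

/-- Every countable locally standard measure algebra is scalar equivalent to an algebra of the
list; all algebras of the list are countable and locally standard; and two algebras of the list
are scalar equivalent exactly if their parameters are identified by `ListEntry.Same`. -/
theorem mainTheorem1 :
    (∀ H : MeasureAlgebra.{u}, Countable H → H.LocallyStandard →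
      ∃ L : ListEntry, MeasureAlgebra.ScalarEquiv H L.algebra) ∧
    (∀ L : ListEntry, Countable L.algebra ∧ L.algebra.LocallyStandard) ∧
    (∀ L L' : ListEntry, MeasureAlgebra.ScalarEquiv L.algebra L'.algebra ↔ L.Same L') := by
  refine ⟨fun H hc hH => ?_, fun L => ⟨L.countable_algebra, L.locallyStandard_algebra⟩,
    fun L L' => ?_⟩
  · obtain ⟨d, hd, hd0⟩ := hH.exists_pos
    obtain ⟨L, α, hα, h⟩ := hH.isValueSet.exists_listEntry hd hd0
    have := L.countable_algebra
    exact ⟨L, MeasureAlgebra.scalarEquiv_of_range_μ hα hH L.locallyStandard_algebra h⟩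
  · have := L.countable_algebra
    have := L'.countable_algebra
    rw [MeasureAlgebra.scalarEquiv_iff L.locallyStandard_algebra L'.locallyStandard_algebra]
    exact ListEntry.proportional_iff_same L L'
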